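/- **Spaces.** An *uncertainty space* is a set with an algebra of subsets (its measurable sets); with the measurable functions (preimages of measurable sets are measurable) these form the category $\mathbf{Unc}$. A *probability measure* on $X$ is a finitely additive $\mu:\Sigma_X\to[0,1]$ with $\mu(\emptyset)=0$, $\mu(X)=1$; an *upper probability* is a pointwise supremum of a nonempty set of probability measures. $\Delta^*X$ is the set of all upper probabilities on $X$, with the algebra generated by the sets $\beta^{p,q}(U)=\{g: g(U)\ge p,\ 1-g(U^c)\ge q\}$ ($p,q\in[0,1]$, $U$ measurable), and $(\Delta^*f)(g)(U)=g(f^{-1}(U))$. Products carry the algebra generated by measurable rectangles, coproducts the algebra generated by the images of measurable sets. An *upper probability polynomial functor* $T$ is built from $Id$ and constant functors $M\in\mathbf{Unc}$ by binary products, binary coproducts and $S\mapsto\Delta^*S$. Its set of ingredients $\mathsf{Ing}\,T$ is given by $\mathsf{Ing}\,Id=\{Id\}$, $\mathsf{Ing}\,M=\{M,Id\}$, $\mathsf{Ing}(T_1\star T_2)=\{T_1\star T_2\}\cup\mathsf{Ing}\,T_1\cup\mathsf{Ing}\,T_2$ for $\star\in\{\times,+\}$, and $\mathsf{Ing}\,\Delta^*S=\{\Delta^*S\}\cup\mathsf{Ing}\,S$.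 A $T$-coalgebra is a morphism $\alpha:X\to TX$ of $\mathbf{Unc}$; a morphism $f:(X,\alpha)\to(Y,\delta)$ is an arrow of $\mathbf{Unc}$ with $\delta f=(Tf)\alpha$. **Formulas** (of sort $S\in\mathsf{Ing}\,T$): $\bot_S$; $\varphi\to\psi$ for $\varphi,\psi$ of sort $S$; $A$ of sort $M$, for $A\subseteq M$ measurable or a singleton; $[\mathsf{pr}_j]\varphi$ of sort $S_1\times S_2$ and $[\mathsf{in}_j]\varphi$ of sort $S_1+S_2$ for $\varphi$ of sort $S_j$; $[\mathsf{next}]\varphi$ of sort $Id$ for $\varphi$ of sort $T$; and $[(p,q)]\varphi$ of sort $\Delta^*S$, for $p,q\in[0,1]$ and $\varphi$ of sort $S$ that is *measurable* (all sets $A$ occurring in it are measurable). $\neg,\vee,\wedge,\leftrightarrow,\top$ are the usual abbreviations. For measurable $\varphi$ put $u_{\ge p}\varphi=[(p,0)]\varphi$, $l_{\ge q}\varphi=[(0,q)]\varphi$, $u_{\le p}\varphi=[(0,1-p)]\neg\varphi$, $u_{<p}\varphi=\neg u_{\ge p}\varphi$. In a coalgebra $(Y,\delta)$ a formula of sort $S$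 is interpreted as a subset $[\![\varphi]\!]$ of $SY$: $\bot$ and $\to$ are Boolean, $[\![A]\!]=A$, $[\![[\mathsf{pr}_j]\varphi]\!]=\pi_j^{-1}[\![\varphi]\!]$, $[\![[\mathsf{in}_1]\varphi]\!]=in_1([\![\varphi]\!])\cup in_2(S_2Y)$ and symmetrically for $[\mathsf{in}_2]$, $[\![[\mathsf{next}]\varphi]\!]=\delta^{-1}[\![\varphi]\!]$, $[\![[(p,q)]\varphi]\!]=\beta^{p,q}[\![\varphi]\!]$. For $y\in SY$ put $des_S^\delta(y)=\{\varphi \text{ of sort } S: y\in[\![\varphi]\!]\}$. **Deduction systems.** The axioms are: Boolean tautologies; $\{c\}\to A$ if $c\in A$ and $\{c\}\to\neg A$ if $c\notin A$ (sort $M$); $\neg[\kappa]\varphi\to[\kappa]\neg\varphi$ for $\kappa\in\{\mathsf{pr}_j,\mathsf{in}_j,\mathsf{next}\}$; $\neg[\mathsf{pr}_j]\bot$; $\neg[\mathsf{next}]\bot$; $\neg[\mathsf{in}_1]\bot\leftrightarrow[\mathsf{in}_2]\bot$; and, for sort $\Delta^*S$, $u_{\le p}\varphi\to u_{<q}\varphi$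 ($p<q$), $u_{<p}\varphi\to u_{\le p}\varphi$, $l_{\ge1}(\varphi\to\psi)\to(u_{\ge p}\varphi\to u_{\ge p}\psi)$, $[(p,q)]\varphi\leftrightarrow(u_{\ge p}\varphi\wedge l_{\ge q}\varphi)$, and the duality $l_{\ge q}\varphi\leftrightarrow u_{\le 1-q}\neg\varphi$. A *$T$-deduction system* $D$ is a family of relations $\vdash_S$ ($S\in\mathsf{Ing}\,T$) between sets of formulas of sort $S$ and formulas of sort $S$ such that: - $\Gamma\vdash_S\varphi$ if $\varphi\in\Gamma$ or $\varphi$ is an axiom; $\{\varphi,\varphi\to\psi\}\vdash_S\psi$; if $\Gamma\vdash_S\psi$ for all $\psi\in\Lambda$ and $\Lambda\vdash_S\varphi$, then $\Gamma\vdash_S\varphi$; if $\Gamma\cup\{\varphi\}\vdash_S\psi$, then $\Gamma\vdash_S\varphi\to\psi$; - if $\vdash_S\varphi$ ($\varphi$ measurable, $\Delta^*S\in\mathsf{Ing}\,T$), then $\vdash_{\Delta^*S}l_{\ge1}\varphi$; $\{\neg\{c\}:c\in M\}\vdash_M\bot_M$; for $\kappa\in\{\mathsf{pr}_j,\mathsf{in}_j,\mathsf{next}\}$,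 $\Gamma\vdash\psi$ implies $\{[\kappa]\theta:\theta\in\Gamma\}\vdash[\kappa]\psi$; - $\{u_{\ge q}\psi:q<p\}\vdash_{\Delta^*S}u_{\ge p}\psi$ and $\{l_{\ge q}\psi:q<p\}\vdash_{\Delta^*S}l_{\ge p}\psi$; - for measurable $\varphi,\varphi_1,\dots,\varphi_m$ of sort $S$, $p_1,\dots,p_m\in[0,1]$, and with $C_k=\bigvee_{I\subseteq\{1,\dots,m\},|I|=k}\bigwedge_{i\in I}\varphi_i$: if $n\ge1$, $\vdash_S\varphi\to C_{n+k}$, $\vdash_SC_k$ and $p=\max(0,\min(1,(\sum_ip_i-k)/n))$, then $\vdash_{\Delta^*S}\bigwedge_iu_{\le p_i}\varphi_i\to u_{\le p}\varphi$; and if $\vdash_SC_k$ and $\sum_ip_i<k$, then $\vdash_{\Delta^*S}\neg\bigwedge_iu_{\le p_i}\varphi_i$. $\Gamma$ is *$\vdash_S$-consistent* if $\Gamma\not\vdash_S\bot_S$, and *$\vdash_S$-maximal* if moreover, for every $\varphi$ of sort $S$, $\varphi\in\Gamma$ iff $\neg\varphi\notin\Gamma$. $D$ is *Lindenbaum* if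 every $\vdash_S$-consistent set is contained in a $\vdash_S$-maximal one ($S\in\mathsf{Ing}\,T$), and *sound* if $\Gamma\vdash_S\varphi$ implies that, in every $T$-coalgebra, every point satisfying all of $\Gamma$ satisfies $\varphi$. Let $X_S$ be the space of all $\vdash_S$-maximal sets, with measurable sets $|\varphi|_S=\{x:\varphi\in x\}$ for measurable $\varphi$ of sort $S$. **Canonical coalgebra.** For a set $x$ of formulas let $[\kappa]^-x=\{\varphi:[\kappa]\varphi\in x\}$. Define $\mathsf r_S:X_S\to S(X_{Id})$ recursively: $\mathsf r_{Id}(x)=x$; $\mathsf r_M(x)$ is the $c$ with $\{c\}\in x$; $\mathsf r_{S_1\times S_2}(x)=(\mathsf r_{S_1}([\mathsf{pr}_1]^-x),\mathsf r_{S_2}([\mathsf{pr}_2]^-x))$; $\mathsf r_{S_1+S_2}(x)=in_j(\mathsf r_{S_j}([\mathsf{in}_j]^-x))$ for the $j$ with $\neg[\mathsf{in}_j]\bot\in x$; and $\mathsf r_{\Delta^*S}(x)(A)=g_x(\mathsf r_S^{-1}(A))$, where $g_x(|\varphi|_S)=\sup\{q\in[0,1]:u_{\ge q}\varphi\in x\}$.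 Put $\alpha^D(x)=\mathsf r_T([\mathsf{next}]^-x)$ for $x\in X_{Id}$. **Theorem 4.7.** Let $T$ be an upper probability polynomial functor and $D$ a sound Lindenbaum $T$-deduction system. The recursion above defines measurable maps $\mathsf r_S$ for all $S\in\mathsf{Ing}\,T$, so that $(X_{Id},\alpha^D)$ is a $T$-coalgebra, and: 1. For every $S\in\mathsf{Ing}\,T$ and every $T$-coalgebra $(Y,\delta)$, $des^\delta_S$ is a measurable map $SY\to X_S$. 2. If $f:(X,\alpha)\to(Y,\delta)$ is a morphism of $T$-coalgebras, then $des_S^\delta\circ Sf=des_S^\alpha$ for all $S\in\mathsf{Ing}\,T$. 3. For every $S\in\mathsf{Ing}\,T$, $des_S^{\alpha^D}:S(X_{Id})\to X_S$ is an isomorphism in $\mathbf{Unc}$ with inverse $\mathsf r_S$; in particular $X_S=\{des_S^{\alpha^D}(\mathsf r_S(x)):x\in X_S\}$. 4. For every $T$-coalgebra $(Y,\delta)$, $des_{Id}^\delta$ is a morphism of $T$-coalgebras $(Y,\delta)\to(X_{Id},\alpha^D)$, and it is the only one; hence $(X_{Id},\alpha^D)$ is the final $T$-coalgebra. -/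

import Mathlib

universe u

open CategoryTheory

/-! ### Uncertainty spaces and their category -/

/-- An uncertainty space: a set together with an algebra of subsets (the measurable sets). -/
structure Unc : Type (u + 1) where
  carrier : Type u
  alg : Set (Set carrier)
  isAlg : MeasureTheory.IsSetAlgebra alg

namespace Unc

/-- Morphisms of uncertainty spaces: measurable functions. -/
@[ext]
structure Hom (X Y : Unc.{u}) : Type u where
  toFun : X.carrier → Y.carrier
  measurable : ∀ U ∈ Y.alg, toFun ⁻¹' U ∈ X.alg

instance : Category.{u} Unc.{u} where
  Hom X Y := Hom X Y
  id X := ⟨fun x => x, fun _ hU => hU⟩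
  comp f g := ⟨fun x => Hom.toFun g (Hom.toFun f x),
    fun U hU => Hom.measurable f _ (Hom.measurable g U hU)⟩

/-- The underlying function of a morphism. -/
def fn {X Y : Unc.{u}} (f : X ⟶ Y) : X.carrier → Y.carrier := Hom.toFun f

theorem fn_meas {X Y : Unc.{u}} (f : X ⟶ Y) {U : Set Y.carrier} (hU : U ∈ Y.alg) :
    fn f ⁻¹' U ∈ X.alg := Hom.measurable f U hU

theorem hom_ext {X Y : Unc.{u}} {f g : X ⟶ Y} (h : ∀ x, fn f x = fn g x) : f = g :=
  Hom.ext (funext h)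

/-- A map into a space with a generated algebra is measurable as soon as the preimages of the
generators are measurable. -/
theorem preimage_generate {X : Unc.{u}} {β : Type u} {G : Set (Set β)} (f : X.carrier → β)
    (h : ∀ U ∈ G, f ⁻¹' U ∈ X.alg) :
    ∀ U ∈ MeasureTheory.generateSetAlgebra G, f ⁻¹' U ∈ X.alg := by
  intro U hU
  induction hU with
  | base s hs => exact h s hs
  | empty => exact X.isAlg.empty_mem
  | compl s _ ih => exact X.isAlg.compl_mem ih
  | union s t _ _ ih1 ih2 => exact X.isAlg.union_mem ih1 ih2

/-- Binary product: the algebra is generated by the measurable rectangles. -/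
def prod (X Y : Unc.{u}) : Unc.{u} where
  carrier := X.carrier × Y.carrier
  alg := MeasureTheory.generateSetAlgebra {W | ∃ U ∈ X.alg, ∃ V ∈ Y.alg, W = U ×ˢ V}
  isAlg := MeasureTheory.isSetAlgebra_generateSetAlgebra

/-- Binary coproduct: the algebra is generated by the images of the measurable sets under the
two inclusions. -/
def sum (X Y : Unc.{u}) : Unc.{u} where
  carrier := X.carrier ⊕ Y.carrier
  alg := MeasureTheory.generateSetAlgebra
    ({W | ∃ U ∈ X.alg, W = Sum.inl '' U} ∪ {W | ∃ V ∈ Y.alg, W = Sum.inr '' V})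
  isAlg := MeasureTheory.isSetAlgebra_generateSetAlgebra

/-! ### Upper probabilities -/

/-- Finitely additive probability measures on the algebra of an uncertainty space. -/
structure IsFinAddProb (X : Unc.{u}) (μ : X.alg → ℝ) : Prop where
  mem_Icc : ∀ U, μ U ∈ Set.Icc (0 : ℝ) 1
  empty : μ ⟨∅, X.isAlg.empty_mem⟩ = 0
  univ : μ ⟨Set.univ, X.isAlg.univ_mem⟩ = 1
  union : ∀ U V : X.alg, Disjoint U.1 V.1 →
    μ ⟨U.1 ∪ V.1, X.isAlg.union_mem U.2 V.2⟩ = μ U + μ V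

/-- Upper probabilities: pointwise suprema of nonempty families of finitely additive probability
measures. -/
def IsUpperProb (X : Unc.{u}) (g : X.alg → ℝ) : Prop :=
  ∃ P : Set (X.alg → ℝ), P.Nonempty ∧ (∀ μ ∈ P, X.IsFinAddProb μ) ∧
    ∀ U, IsLUB ((fun μ => μ U) '' P) (g U)

/-- The set `β^{p,q}(U)` of the upper probabilities `g` whose upper value at `U` is at least `p`
and whose lower value `1 - g(Uᶜ)` is at least `q`. -/
def beta (X : Unc.{u}) (p q : unitInterval) (U : X.alg) : Set {g : X.alg → ℝ // X.IsUpperProb g} :=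
  {g | (p : ℝ) ≤ g.1 U ∧ (q : ℝ) ≤ 1 - g.1 ⟨U.1ᶜ, X.isAlg.compl_mem U.2⟩}

/-- The space `Δ*X` of all upper probabilities on `X`. -/
def delta (X : Unc.{u}) : Unc.{u} where
  carrier := {g : X.alg → ℝ // X.IsUpperProb g}
  alg := MeasureTheory.generateSetAlgebra {W | ∃ p q U, W = X.beta p q U}
  isAlg := MeasureTheory.isSetAlgebra_generateSetAlgebra

/-! ### Actions on morphisms -/

/-- The product of two measurable functions. -/
def prodMap {X Y X' Y' : Unc.{u}} (f : X ⟶ X') (g : Y ⟶ Y') : X.prod Y ⟶ X'.prod Y' :=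
  Hom.mk (X := X.prod Y) (Y := X'.prod Y') (Prod.map (fn f) (fn g)) (by
    apply preimage_generate (X := X.prod Y)
    rintro _ ⟨U, hU, V, hV, rfl⟩
    exact .base _ ⟨_, fn_meas f hU, _, fn_meas g hV, rfl⟩)

theorem map_preimage_inl {A B C D : Type u} (f : A → C) (g : B → D) (U : Set C) :
    Sum.map f g ⁻¹' (Sum.inl '' U) = Sum.inl '' (f ⁻¹' U) := by
  ext (x | x) <;> simp

theorem map_preimage_inr {A B C D : Type u} (f : A → C) (g : B → D) (U : Set D) :
    Sum.map f g ⁻¹' (Sum.inr '' U) = Sum.inr '' (g ⁻¹' U) := by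
  ext (x | x) <;> simp

/-- The coproduct of two measurable functions. -/
def sumMap {X Y X' Y' : Unc.{u}} (f : X ⟶ X') (g : Y ⟶ Y') : X.sum Y ⟶ X'.sum Y' :=
  Hom.mk (X := X.sum Y) (Y := X'.sum Y') (Sum.map (fn f) (fn g)) (by
    apply preimage_generate (X := X.sum Y)
    rintro _ (⟨U, hU, rfl⟩ | ⟨U, hU, rfl⟩)
    · exact .base _ (Or.inl ⟨_, fn_meas f hU, map_preimage_inl (fn f) (fn g) U⟩)
    · exact .base _ (Or.inr ⟨_, fn_meas g hU, map_preimage_inr (fn f) (fn g) U⟩))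

/-- The pushforward of a set function: `(Δ*f)(g)(U) = g(f⁻¹(U))`. -/
def push {X Y : Unc.{u}} (f : X ⟶ Y) (g : X.alg → ℝ) : Y.alg → ℝ :=
  fun U => g ⟨fn f ⁻¹' U.1, fn_meas f U.2⟩

theorem push_isUpperProb {X Y : Unc.{u}} (f : X ⟶ Y) {g : X.alg → ℝ} (hg : X.IsUpperProb g) :
    Y.IsUpperProb (push f g) := by
  obtain ⟨P, hne, hP, hlub⟩ := hg
  refine ⟨push f '' P, hne.image _, ?_, fun U => ?_⟩
  · rintro _ ⟨μ, hμ, rfl⟩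
    exact ⟨fun U => (hP μ hμ).mem_Icc _, (hP μ hμ).empty, (hP μ hμ).univ,
      fun U V hUV => (hP μ hμ).union ⟨_, fn_meas f U.2⟩ ⟨_, fn_meas f V.2⟩
        (hUV.preimage (fn f))⟩
  · rw [Set.image_image]
    exact hlub ⟨_, fn_meas f U.2⟩

/-- The action of `Δ*` on morphisms. -/
def deltaMap {X Y : Unc.{u}} (f : X ⟶ Y) : X.delta ⟶ Y.delta :=
  Hom.mk (X := X.delta) (Y := Y.delta) (fun g => ⟨push f g.1, push_isUpperProb f g.2⟩) (by
    apply preimage_generate (X := X.delta)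
    rintro _ ⟨p, q, U, rfl⟩
    exact .base _ ⟨p, q, ⟨_, fn_meas f U.2⟩, rfl⟩)

/-- The endofunctor `Δ*`. -/
def deltaFunctor : Unc.{u} ⥤ Unc.{u} where
  obj X := X.delta
  map f := deltaMap f

/-- The pointwise product of two endofunctors. -/
def prodFunctor (F G : Unc.{u} ⥤ Unc.{u}) : Unc.{u} ⥤ Unc.{u} where
  obj X := (F.obj X).prod (G.obj X)
  map f := prodMap (F.map f) (G.map f)
  map_id X := by
    rw [F.map_id, G.map_id]
    exact hom_ext fun x => rfl
  map_comp f g := by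
    rw [F.map_comp, G.map_comp]
    exact hom_ext fun x => rfl

/-- The pointwise coproduct of two endofunctors. -/
def sumFunctor (F G : Unc.{u} ⥤ Unc.{u}) : Unc.{u} ⥤ Unc.{u} where
  obj X := (F.obj X).sum (G.obj X)
  map f := sumMap (F.map f) (G.map f)
  map_id X := by
    rw [F.map_id, G.map_id]
    exact hom_ext fun x => by rcases x with x | x <;> rfl
  map_comp f g := by
    rw [F.map_comp, G.map_comp]
    exact hom_ext fun x => by rcases x with x | x <;> rfl

end Unc

/-! ### Upper probability polynomial functors and their ingredients -/

/-- Expressions for upper probability polynomial functors. The constant functors occurring in an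
expression are named by the elements of `ι`; a family `M : ι → Unc` says which spaces they are. -/
inductive UPoly (ι : Type u) : Type u
  | ident : UPoly ι
  | const (i : ι) : UPoly ι
  | prod (S₁ S₂ : UPoly ι) : UPoly ι
  | sum (S₁ S₂ : UPoly ι) : UPoly ι
  | delta (S : UPoly ι) : UPoly ι

namespace UPoly

variable {ι : Type u}

/-- The endofunctor of the category of uncertainty spaces denoted by an expression. -/
def functor (M : ι → Unc.{u}) : UPoly ι → (Unc.{u} ⥤ Unc.{u})
  | ident => 𝟭 Unc.{u}
  | const i => (Functor.const Unc.{u}).obj (M i)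
  | prod S₁ S₂ => Unc.prodFunctor (S₁.functor M) (S₂.functor M)
  | sum S₁ S₂ => Unc.sumFunctor (S₁.functor M) (S₂.functor M)
  | delta S => S.functor M ⋙ Unc.deltaFunctor

/-- The set of ingredients. -/
def Ing : UPoly ι → Set (UPoly ι)
  | ident => {ident}
  | const i => {const i, ident}
  | prod S₁ S₂ => {prod S₁ S₂} ∪ Ing S₁ ∪ Ing S₂
  | sum S₁ S₂ => {sum S₁ S₂} ∪ Ing S₁ ∪ Ing S₂
  | delta S => {delta S} ∪ Ing S

theorem self_mem_Ing (T : UPoly ι) : T ∈ T.Ing := by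
  cases T <;> simp [Ing]

theorem ident_mem_Ing (T : UPoly ι) : ident ∈ T.Ing := by
  induction T <;> simp_all [Ing]

theorem Ing_trans {T S R : UPoly ι} (hS : S ∈ T.Ing) (hR : R ∈ S.Ing) : R ∈ T.Ing := by
  induction T with
  | ident => simp only [Ing, Set.mem_singleton_iff] at hS; subst hS; exact hR
  | const i =>
    simp only [Ing, Set.mem_insert_iff, Set.mem_singleton_iff] at hS
    rcases hS with rfl | rfl
    · exact hR
    · simp only [Ing, Set.mem_singleton_iff] at hR; subst hR; exact ident_mem_Ing _
  | prod S₁ S₂ ih₁ ih₂ =>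
    rcases hS with (hS | hS) | hS
    · rw [Set.mem_singleton_iff] at hS; subst hS; exact hR
    · exact Or.inl (Or.inr (ih₁ hS))
    · exact Or.inr (ih₂ hS)
  | sum S₁ S₂ ih₁ ih₂ =>
    rcases hS with (hS | hS) | hS
    · rw [Set.mem_singleton_iff] at hS; subst hS; exact hR
    · exact Or.inl (Or.inr (ih₁ hS))
    · exact Or.inr (ih₂ hS)
  | delta S' ih =>
    rcases hS with hS | hS
    · rw [Set.mem_singleton_iff] at hS; subst hS; exact hR
    · exact Or.inr (ih hS)

theorem prod_left_mem {T S₁ S₂ : UPoly ι} (h : prod S₁ S₂ ∈ T.Ing) : S₁ ∈ T.Ing :=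
  Ing_trans h (Or.inl (Or.inr (self_mem_Ing S₁)))

theorem prod_right_mem {T S₁ S₂ : UPoly ι} (h : prod S₁ S₂ ∈ T.Ing) : S₂ ∈ T.Ing :=
  Ing_trans h (Or.inr (self_mem_Ing S₂))

theorem sum_left_mem {T S₁ S₂ : UPoly ι} (h : sum S₁ S₂ ∈ T.Ing) : S₁ ∈ T.Ing :=
  Ing_trans h (Or.inl (Or.inr (self_mem_Ing S₁)))

theorem sum_right_mem {T S₁ S₂ : UPoly ι} (h : sum S₁ S₂ ∈ T.Ing) : S₂ ∈ T.Ing :=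
  Ing_trans h (Or.inr (self_mem_Ing S₂))

theorem delta_mem {T S : UPoly ι} (h : delta S ∈ T.Ing) : S ∈ T.Ing :=
  Ing_trans h (Or.inr (self_mem_Ing S))

end UPoly

/-- Coalgebras for the functor denoted by `T`. -/
abbrev TCoalg {ι : Type u} (M : ι → Unc.{u}) (T : UPoly ι) := Endofunctor.Coalgebra (T.functor M)

/-! ### Formulas -/

/-- Raw formulas of each sort, without the side conditions on the atoms. -/
inductive RawForm {ι : Type u} (M : ι → Unc.{u}) (T : UPoly ι) : UPoly ι → Type u
  | bot {S : UPoly ι} : RawForm M T S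
  | imp {S : UPoly ι} (φ ψ : RawForm M T S) : RawForm M T S
  | atom {i : ι} (A : Set (M i).carrier) : RawForm M T (.const i)
  | pr₁ {S₁ S₂ : UPoly ι} (φ : RawForm M T S₁) : RawForm M T (.prod S₁ S₂)
  | pr₂ {S₁ S₂ : UPoly ι} (φ : RawForm M T S₂) : RawForm M T (.prod S₁ S₂)
  | in₁ {S₁ S₂ : UPoly ι} (φ : RawForm M T S₁) : RawForm M T (.sum S₁ S₂)
  | in₂ {S₁ S₂ : UPoly ι} (φ : RawForm M T S₂) : RawForm M T (.sum S₁ S₂)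
  | next (φ : RawForm M T T) : RawForm M T .ident
  | box {S : UPoly ι} (p q : unitInterval) (φ : RawForm M T S) : RawForm M T (.delta S)

namespace RawForm

variable {ι : Type u} {M : ι → Unc.{u}} {T : UPoly ι}

/-- `φ :: S`, i.e. all atoms occurring in `φ` are measurable sets. -/
def Meas : {S : UPoly ι} → RawForm M T S → Prop
  | _, bot => True
  | _, imp φ ψ => φ.Meas ∧ ψ.Meas
  | _, atom (i := i) A => A ∈ (M i).alg
  | _, pr₁ φ => φ.Meas
  | _, pr₂ φ => φ.Meas
  | _, in₁ φ => φ.Meas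
  | _, in₂ φ => φ.Meas
  | _, next φ => φ.Meas
  | _, box _ _ φ => φ.Meas

/-- `φ : S`, i.e. every atom occurring in `φ` is a measurable set or a singleton, and the
probabilistic modalities are only applied to measurable formulas. -/
def WF : {S : UPoly ι} → RawForm M T S → Prop
  | _, bot => True
  | _, imp φ ψ => φ.WF ∧ ψ.WF
  | _, atom (i := i) A => A ∈ (M i).alg ∨ ∃ c, A = {c}
  | _, pr₁ φ => φ.WF
  | _, pr₂ φ => φ.WF
  | _, in₁ φ => φ.WF
  | _, in₂ φ => φ.WF
  | _, next φ => φ.WF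
  | _, box _ _ φ => φ.Meas

/-- The interpretation of a formula in a coalgebra. (For a formula `[(p,q)]φ` the interpretation
of `φ` is always measurable, because `φ` is a measurable formula.) -/
def interp (Y : TCoalg M T) :
    {S : UPoly ι} → RawForm M T S → Set ((S.functor M).obj Y.V).carrier
  | _, bot => ∅
  | _, imp φ ψ => (φ.interp Y)ᶜ ∪ ψ.interp Y
  | _, atom (i := i) A => (show Set (M i).carrier from A)
  | _, pr₁ (S₁ := S₁) (S₂ := S₂) φ =>
      (show Set (((S₁.functor M).obj Y.V).carrier × ((S₂.functor M).obj Y.V).carrier) from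
        Prod.fst ⁻¹' φ.interp Y)
  | _, pr₂ (S₁ := S₁) (S₂ := S₂) φ =>
      (show Set (((S₁.functor M).obj Y.V).carrier × ((S₂.functor M).obj Y.V).carrier) from
        Prod.snd ⁻¹' φ.interp Y)
  | _, in₁ (S₁ := S₁) (S₂ := S₂) φ =>
      (show Set (((S₁.functor M).obj Y.V).carrier ⊕ ((S₂.functor M).obj Y.V).carrier) from
        Sum.inl '' φ.interp Y ∪ Set.range Sum.inr)
  | _, in₂ (S₁ := S₁) (S₂ := S₂) φ =>
      (show Set (((S₁.functor M).obj Y.V).carrier ⊕ ((S₂.functor M).obj Y.V).carrier) from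
        Set.range Sum.inl ∪ Sum.inr '' φ.interp Y)
  | _, next φ => (show Set Y.V.carrier from Unc.fn Y.str ⁻¹' φ.interp Y)
  | _, box (S := S) p q φ =>
      (show Set ((S.functor M).obj Y.V).delta.carrier from
        {g | ∃ hU : φ.interp Y ∈ ((S.functor M).obj Y.V).alg,
          g ∈ ((S.functor M).obj Y.V).beta p q ⟨φ.interp Y, hU⟩})

theorem Meas.wf {S : UPoly ι} {φ : RawForm M T S} (h : φ.Meas) : φ.WF := by
  induction φ with
  | bot => trivial
  | imp φ ψ ih₁ ih₂ => exact ⟨ih₁ h.1, ih₂ h.2⟩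
  | atom A => exact Or.inl h
  | pr₁ φ ih => exact ih h
  | pr₂ φ ih => exact ih h
  | in₁ φ ih => exact ih h
  | in₂ φ ih => exact ih h
  | next φ ih => exact ih h
  | box p q φ ih => exact h

end RawForm

/-- The formulas of sort `S`. -/
def Form {ι : Type u} (M : ι → Unc.{u}) (T S : UPoly ι) : Type u := {φ : RawForm M T S // φ.WF}

namespace Form

variable {ι : Type u} {M : ι → Unc.{u}} {T S S₁ S₂ : UPoly ι}

/-- `φ :: S`: the formula `φ` is measurable. -/
def Meas (φ : Form M T S) : Prop := φ.1.Meas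

/-- Satisfaction: `Y, y ⊨ φ`. -/
def Sat (Y : TCoalg M T) (y : ((S.functor M).obj Y.V).carrier) (φ : Form M T S) : Prop :=
  y ∈ φ.1.interp Y

def bot : Form M T S := ⟨.bot, trivial⟩
def imp (φ ψ : Form M T S) : Form M T S := ⟨.imp φ.1 ψ.1, φ.2, ψ.2⟩
def neg (φ : Form M T S) : Form M T S := φ.imp bot
def top : Form M T S := (bot : Form M T S).neg
def or (φ ψ : Form M T S) : Form M T S := φ.neg.imp ψ
def and (φ ψ : Form M T S) : Form M T S := (φ.neg.or ψ.neg).neg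
def iff (φ ψ : Form M T S) : Form M T S := (φ.imp ψ).and (ψ.imp φ)

/-- The atom given by a measurable set or a singleton. -/
def atom {i : ι} (A : Set (M i).carrier) (hA : A ∈ (M i).alg ∨ ∃ c, A = {c}) :
    Form M T (.const i) := ⟨.atom A, hA⟩

/-- The atom given by a singleton. -/
def single {i : ι} (c : (M i).carrier) : Form M T (.const i) := atom {c} (Or.inr ⟨c, rfl⟩)

def pr₁ (φ : Form M T S₁) : Form M T (.prod S₁ S₂) := ⟨.pr₁ φ.1, φ.2⟩
def pr₂ (φ : Form M T S₂) : Form M T (.prod S₁ S₂) := ⟨.pr₂ φ.1, φ.2⟩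
def in₁ (φ : Form M T S₁) : Form M T (.sum S₁ S₂) := ⟨.in₁ φ.1, φ.2⟩
def in₂ (φ : Form M T S₂) : Form M T (.sum S₁ S₂) := ⟨.in₂ φ.1, φ.2⟩
def next (φ : Form M T T) : Form M T .ident := ⟨.next φ.1, φ.2⟩

/-- `[(p,q)]φ`, for a measurable formula `φ`. -/
def box (p q : unitInterval) (φ : Form M T S) (h : φ.Meas) : Form M T (.delta S) :=
  ⟨.box p q φ.1, h⟩

theorem Meas.imp {φ ψ : Form M T S} (hφ : φ.Meas) (hψ : ψ.Meas) : (φ.imp ψ).Meas := ⟨hφ, hψ⟩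

theorem Meas.neg {φ : Form M T S} (hφ : φ.Meas) : φ.neg.Meas := ⟨hφ, trivial⟩

/-- The upper probability of `φ` is at least `p`. -/
def upperGe (p : unitInterval) (φ : Form M T S) (h : φ.Meas) : Form M T (.delta S) := box p 0 φ h

/-- The lower probability of `φ` is at least `q`. -/
def lowerGe (q : unitInterval) (φ : Form M T S) (h : φ.Meas) : Form M T (.delta S) := box 0 q φ h

/-- The upper probability of `φ` is at most `p`, expressed as `[(0,1-p)]¬φ`. -/
def upperLe (p : unitInterval) (φ : Form M T S) (h : φ.Meas) : Form M T (.delta S) :=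
  box 0 (unitInterval.symm p) φ.neg h.neg

/-- The upper probability of `φ` is less than `p`. -/
def upperLt (p : unitInterval) (φ : Form M T S) (h : φ.Meas) : Form M T (.delta S) :=
  (upperGe p φ h).neg

/-- Finite conjunctions. -/
def bigAnd (l : List (Form M T S)) : Form M T S := l.foldr and top

/-- Finite disjunctions. -/
def bigOr (l : List (Form M T S)) : Form M T S := l.foldr or bot

/-- The formula saying that at least `k` of the formulas `φ₁, …, φₘ` hold: the disjunction, over
all sets `I` of `k` indices, of the conjunctions of the `φᵢ` with `i ∈ I`. -/
noncomputable def atLeast {m : ℕ} (k : ℕ) (φ : Fin m → Form M T S) : Form M T S :=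
  bigOr ((Finset.powersetCard k (Finset.univ : Finset (Fin m))).toList.map
    fun I => bigAnd (I.toList.map φ))

/-- Boolean tautologies: formulas that are true under every valuation of the formulas of their
sort respecting falsum and implication. -/
def IsTautology (φ : Form M T S) : Prop :=
  ∀ v : Form M T S → Prop, ¬ v bot → (∀ a b, v (a.imp b) ↔ (v a → v b)) → v φ

end Form

/-! ### Deduction systems -/

open Form in
/-- The logical axioms of each sort. The clause `duality` records that `lowerGe q φ` and
`upperLe (1-q) (¬φ)` are two ways of writing the same condition. -/
inductive Ax {ι : Type u} (M : ι → Unc.{u}) (T : UPoly ι) : {S : UPoly ι} → Form M T S → Prop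
  | tautology {S : UPoly ι} (φ : Form M T S) : φ.IsTautology → Ax M T φ
  | const_mem {i : ι} (c : (M i).carrier) (A : Set (M i).carrier)
      (hA : A ∈ (M i).alg ∨ ∃ d, A = {d}) : c ∈ A → Ax M T ((single c).imp (atom A hA))
  | const_notMem {i : ι} (c : (M i).carrier) (A : Set (M i).carrier)
      (hA : A ∈ (M i).alg ∨ ∃ d, A = {d}) : c ∉ A → Ax M T ((single c).imp (atom A hA).neg)
  | pr₁_neg {S₁ S₂ : UPoly ι} (φ : Form M T S₁) :
      Ax M T ((pr₁ φ : Form M T (.prod S₁ S₂)).neg.imp (pr₁ φ.neg))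
  | pr₂_neg {S₁ S₂ : UPoly ι} (φ : Form M T S₂) :
      Ax M T ((pr₂ φ : Form M T (.prod S₁ S₂)).neg.imp (pr₂ φ.neg))
  | pr₁_bot {S₁ S₂ : UPoly ι} : Ax M T (pr₁ bot : Form M T (.prod S₁ S₂)).neg
  | pr₂_bot {S₁ S₂ : UPoly ι} : Ax M T (pr₂ bot : Form M T (.prod S₁ S₂)).neg
  | in₁_neg {S₁ S₂ : UPoly ι} (φ : Form M T S₁) :
      Ax M T ((in₁ φ : Form M T (.sum S₁ S₂)).neg.imp (in₁ φ.neg))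
  | in₂_neg {S₁ S₂ : UPoly ι} (φ : Form M T S₂) :
      Ax M T ((in₂ φ : Form M T (.sum S₁ S₂)).neg.imp (in₂ φ.neg))
  | in_bot {S₁ S₂ : UPoly ι} : Ax M T ((in₁ bot : Form M T (.sum S₁ S₂)).neg.iff (in₂ bot))
  | next_neg (φ : Form M T T) : Ax M T ((next φ).neg.imp (next φ.neg))
  | next_bot : Ax M T (next (bot : Form M T T)).neg
  | upperLe_upperLt {S : UPoly ι} (p q : unitInterval) (φ : Form M T S) (h : φ.Meas) :
      p < q → Ax M T ((upperLe p φ h).imp (upperLt q φ h))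
  | upperLt_upperLe {S : UPoly ι} (p : unitInterval) (φ : Form M T S) (h : φ.Meas) :
      Ax M T ((upperLt p φ h).imp (upperLe p φ h))
  | upperGe_mono {S : UPoly ι} (p : unitInterval) (φ ψ : Form M T S) (hφ : φ.Meas) (hψ : ψ.Meas) :
      Ax M T ((lowerGe 1 (φ.imp ψ) (hφ.imp hψ)).imp ((upperGe p φ hφ).imp (upperGe p ψ hψ)))
  | box_iff {S : UPoly ι} (p q : unitInterval) (φ : Form M T S) (h : φ.Meas) :
      Ax M T ((box p q φ h).iff ((upperGe p φ h).and (lowerGe q φ h)))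
  | duality {S : UPoly ι} (q : unitInterval) (φ : Form M T S) (h : φ.Meas) :
      Ax M T ((lowerGe q φ h).iff (upperLe (unitInterval.symm q) φ.neg h.neg))

open Form in
/-- A `T`-deduction system: a family of relations `⊢_S`, one for each ingredient `S` of `T`,
closed under the rules below. -/
structure DeductionSystem {ι : Type u} (M : ι → Unc.{u}) (T : UPoly ι) where
  Prov : {S : UPoly ι} → S ∈ T.Ing → Set (Form M T S) → Form M T S → Prop
  assumption : ∀ {S : UPoly ι} (hS : S ∈ T.Ing) (Γ : Set (Form M T S)) (φ : Form M T S),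
    φ ∈ Γ ∨ Ax M T φ → Prov hS Γ φ
  modusPonens : ∀ {S : UPoly ι} (hS : S ∈ T.Ing) (φ ψ : Form M T S), Prov hS {φ, φ.imp ψ} ψ
  cut : ∀ {S : UPoly ι} (hS : S ∈ T.Ing) (Γ Λ : Set (Form M T S)) (φ : Form M T S),
    (∀ ψ ∈ Λ, Prov hS Γ ψ) → Prov hS Λ φ → Prov hS Γ φ
  deduction : ∀ {S : UPoly ι} (hS : S ∈ T.Ing) (Γ : Set (Form M T S)) (φ ψ : Form M T S),
    Prov hS (Γ ∪ {φ}) ψ → Prov hS Γ (φ.imp ψ)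
  necessitation : ∀ {S : UPoly ι} (hS : S.delta ∈ T.Ing) (φ : Form M T S) (h : φ.Meas),
    Prov (UPoly.delta_mem hS) ∅ φ → Prov hS ∅ (lowerGe 1 φ h)
  constant : ∀ {i : ι} (hS : UPoly.const i ∈ T.Ing),
    Prov hS {ψ | ∃ c : (M i).carrier, ψ = (single c).neg} bot
  box_pr₁ : ∀ {S₁ S₂ : UPoly ι} (hS : S₁.prod S₂ ∈ T.Ing) (Γ : Set (Form M T S₁))
    (ψ : Form M T S₁), Prov (UPoly.prod_left_mem hS) Γ ψ → Prov hS (pr₁ '' Γ) (pr₁ ψ)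
  box_pr₂ : ∀ {S₁ S₂ : UPoly ι} (hS : S₁.prod S₂ ∈ T.Ing) (Γ : Set (Form M T S₂))
    (ψ : Form M T S₂), Prov (UPoly.prod_right_mem hS) Γ ψ → Prov hS (pr₂ '' Γ) (pr₂ ψ)
  box_in₁ : ∀ {S₁ S₂ : UPoly ι} (hS : S₁.sum S₂ ∈ T.Ing) (Γ : Set (Form M T S₁))
    (ψ : Form M T S₁), Prov (UPoly.sum_left_mem hS) Γ ψ → Prov hS (in₁ '' Γ) (in₁ ψ)
  box_in₂ : ∀ {S₁ S₂ : UPoly ι} (hS : S₁.sum S₂ ∈ T.Ing) (Γ : Set (Form M T S₂))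
    (ψ : Form M T S₂), Prov (UPoly.sum_right_mem hS) Γ ψ → Prov hS (in₂ '' Γ) (in₂ ψ)
  box_next : ∀ (Γ : Set (Form M T T)) (ψ : Form M T T),
    Prov (UPoly.self_mem_Ing T) Γ ψ → Prov (UPoly.ident_mem_Ing T) (next '' Γ) (next ψ)
  archimedean_upper : ∀ {S : UPoly ι} (hS : S.delta ∈ T.Ing) (p : unitInterval) (ψ : Form M T S)
    (h : ψ.Meas), Prov hS {θ | ∃ q < p, θ = upperGe q ψ h} (upperGe p ψ h)
  archimedean_lower : ∀ {S : UPoly ι} (hS : S.delta ∈ T.Ing) (p : unitInterval) (ψ : Form M T S)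
    (h : ψ.Meas), Prov hS {θ | ∃ q < p, θ = lowerGe q ψ h} (lowerGe p ψ h)
  cover_pos : ∀ {S : UPoly ι} (hS : S.delta ∈ T.Ing) (m n k : ℕ) (φ : Form M T S) (h : φ.Meas)
    (φs : Fin m → Form M T S) (hs : ∀ i, (φs i).Meas) (ps : Fin m → unitInterval)
    (p : unitInterval), 1 ≤ n →
    Prov (UPoly.delta_mem hS) ∅ (φ.imp (atLeast (n + k) φs)) →
    Prov (UPoly.delta_mem hS) ∅ (atLeast k φs) →
    (p : ℝ) = max 0 (min 1 ((∑ i, (ps i : ℝ) - k) / n)) →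
    Prov hS ∅ ((bigAnd (List.ofFn fun i => upperLe (ps i) (φs i) (hs i))).imp (upperLe p φ h))
  cover_zero : ∀ {S : UPoly ι} (hS : S.delta ∈ T.Ing) (m k : ℕ)
    (φs : Fin m → Form M T S) (hs : ∀ i, (φs i).Meas) (ps : Fin m → unitInterval),
    Prov (UPoly.delta_mem hS) ∅ (atLeast k φs) → ∑ i, (ps i : ℝ) < k →
    Prov hS ∅ (bigAnd (List.ofFn fun i => upperLe (ps i) (φs i) (hs i))).neg

namespace DeductionSystem

variable {ι : Type u} {M : ι → Unc.{u}} {T : UPoly ι} (D : DeductionSystem M T)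

/-- Soundness with respect to all coalgebras. -/
def Sound : Prop :=
  ∀ {S : UPoly ι} (hS : S ∈ T.Ing) (Γ : Set (Form M T S)) (φ : Form M T S), D.Prov hS Γ φ →
    ∀ (Y : TCoalg M T) (y : ((S.functor M).obj Y.V).carrier),
      (∀ ψ ∈ Γ, Form.Sat Y y ψ) → Form.Sat Y y φ

def Consistent {S : UPoly ι} (hS : S ∈ T.Ing) (Γ : Set (Form M T S)) : Prop :=
  ¬ D.Prov hS Γ Form.bot

/-- Maximal sets: negation complete and consistent. -/
def IsMaximal {S : UPoly ι} (hS : S ∈ T.Ing) (Γ : Set (Form M T S)) : Prop :=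
  (∀ φ : Form M T S, φ ∈ Γ ↔ φ.neg ∉ Γ) ∧ D.Consistent hS Γ

/-- Every consistent set of formulas is contained in a maximal one. -/
def Lindenbaum : Prop :=
  ∀ {S : UPoly ι} (hS : S ∈ T.Ing) (Γ : Set (Form M T S)), D.Consistent hS Γ →
    ∃ x, D.IsMaximal hS x ∧ Γ ⊆ x

variable {D} in
/-- Maximal sets are closed under deduction. -/
theorem IsMaximal.closed {S : UPoly ι} {hS : S ∈ T.Ing} {x : Set (Form M T S)}
    (hx : D.IsMaximal hS x) {φ : Form M T S} (h : D.Prov hS x φ) : φ ∈ x := by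
  by_contra hφ
  have hneg : φ.neg ∈ x := by
    by_contra h'
    exact hφ ((hx.1 φ).2 h')
  refine hx.2 (D.cut hS x {φ, φ.imp Form.bot} _ ?_ (D.modusPonens hS φ Form.bot))
  rintro ψ (rfl | rfl)
  · exact h
  · exact D.assumption hS _ _ (Or.inl hneg)

variable {D} in
theorem IsMaximal.imp_iff {S : UPoly ι} {hS : S ∈ T.Ing} {x : Set (Form M T S)}
    (hx : D.IsMaximal hS x) (φ ψ : Form M T S) : φ.imp ψ ∈ x ↔ (φ ∈ x → ψ ∈ x) := by
  have mono : ∀ θ, Form.IsTautology θ → θ ∈ x := fun θ hθ =>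
    hx.closed (D.assumption hS _ _ (Or.inr (.tautology θ hθ)))
  have mp : ∀ a b : Form M T S, a ∈ x → a.imp b ∈ x → b ∈ x := by
    intro a b ha hab
    refine hx.closed (D.cut hS x {a, a.imp b} _ ?_ (D.modusPonens hS a b))
    rintro θ (rfl | rfl)
    exacts [D.assumption hS _ _ (Or.inl ha), D.assumption hS _ _ (Or.inl hab)]
  refine ⟨fun h hφ => mp _ _ hφ h, fun h => ?_⟩
  by_cases hφ : φ ∈ x
  · refine mp ψ _ (h hφ) (mono _ fun v _ hv => ?_)
    rw [hv, hv]; tauto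
  · have hneg : φ.neg ∈ x := by
      by_contra h'
      exact hφ ((hx.1 φ).2 h')
    refine mp φ.neg _ hneg (mono _ fun v hb hv => ?_)
    rw [hv, hv, Form.neg, hv]; tauto

/-- The set `|φ|_S` of the maximal sets containing `φ`. -/
def ext {S : UPoly ι} (hS : S ∈ T.Ing) (φ : Form M T S) : Set {x // D.IsMaximal hS x} :=
  {x | φ ∈ x.1}

/-- The space `X_S` of the maximal sets of sort `S`; its measurable sets are the sets `|φ|_S` with
`φ` a measurable formula. -/
def space {S : UPoly ι} (hS : S ∈ T.Ing) : Unc.{u} where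
  carrier := {x : Set (Form M T S) // D.IsMaximal hS x}
  alg := {A | ∃ φ : Form M T S, φ.Meas ∧ A = D.ext hS φ}
  isAlg := by
    refine ⟨⟨Form.bot, trivial, ?_⟩, ?_, ?_⟩
    · ext x
      simp only [Set.mem_empty_iff_false, false_iff]
      exact fun h => x.2.2 (D.assumption hS _ _ (Or.inl h))
    · rintro _ ⟨φ, hφ, rfl⟩
      refine ⟨φ.neg, hφ.neg, ?_⟩
      ext x
      have := x.2.1 φ
      change ¬ (φ ∈ x.1) ↔ φ.neg ∈ x.1
      tauto
    · rintro _ _ ⟨φ, hφ, rfl⟩ ⟨ψ, hψ, rfl⟩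
      refine ⟨φ.or ψ, hφ.neg.imp hψ, ?_⟩
      ext x
      have h1 := x.2.1 φ
      have h2 := x.2.imp_iff φ.neg ψ
      change (φ ∈ x.1 ∨ ψ ∈ x.1) ↔ φ.neg.imp ψ ∈ x.1
      tauto

/-- The space `X_Id`. -/
abbrev spaceId : Unc.{u} := D.space (UPoly.ident_mem_Ing T)

/-- The description map `des_S : SY → X_S`, sending `y` to the set of the formulas it satisfies. -/
def des {D : DeductionSystem M T} (hD : D.Sound) (Y : TCoalg M T) {S : UPoly ι} (hS : S ∈ T.Ing)
    (y : ((S.functor M).obj Y.V).carrier) : (D.space hS).carrier :=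
  ⟨{φ | Form.Sat Y y φ}, by
    refine ⟨fun φ => ?_, fun h => (hD hS _ _ h Y y fun _ hψ => hψ).elim⟩
    change y ∈ φ.1.interp Y ↔ ¬ (¬ (y ∈ φ.1.interp Y) ∨ y ∈ (∅ : Set _))
    simp⟩

/-- The map `ρ_Id : X_Id → X_T` sending `x` to `{ψ | [next]ψ ∈ x}`. -/
def rhoId (x : D.spaceId.carrier) : (D.space (UPoly.self_mem_Ing T)).carrier :=
  ⟨{ψ | ψ.next ∈ x.1}, by
    have hbot : (Form.next (Form.bot : Form M T T)) ∉ x.1 := fun h =>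
      (x.2.1 _).1 h (x.2.closed (D.assumption _ _ _ (Or.inr .next_bot)))
    have hbox : ∀ (Γ : Set (Form M T T)) (ψ : Form M T T), (∀ θ ∈ Γ, θ.next ∈ x.1) →
        D.Prov (UPoly.self_mem_Ing T) Γ ψ → ψ.next ∈ x.1 := by
      intro Γ ψ hΓ h
      refine x.2.closed (D.cut _ _ _ _ ?_ (D.box_next Γ ψ h))
      rintro _ ⟨θ, hθ, rfl⟩
      exact D.assumption _ _ _ (Or.inl (hΓ θ hθ))
    refine ⟨fun φ => ⟨fun h h' => hbot ?_, fun h => ?_⟩, fun h => hbot ?_⟩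
    · refine hbox {φ, φ.imp Form.bot} _ ?_ (D.modusPonens _ φ Form.bot)
      rintro θ (rfl | rfl)
      exacts [h, h']
    · refine (x.2.1 _).2 fun hn => h ?_
      exact (x.2.imp_iff _ _).1 (x.2.closed (D.assumption _ _ _ (Or.inr (.next_neg φ)))) hn
    · exact hbox _ _ (fun θ hθ => hθ) h⟩

/-- The value `g_x(|φ|) = sup {q ∈ [0,1] | upperGe q φ ∈ x}` of the canonical measure. -/
noncomputable def canonicalMeasure {S : UPoly ι} (x : Set (Form M T S.delta)) (φ : Form M T S)
    (h : φ.Meas) : ℝ :=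
  sSup {r : ℝ | ∃ q : unitInterval, r = q ∧ Form.upperGe q φ h ∈ x}

/-- The graph of the map `r_S : X_S → S(X_Id)`, by recursion on `S`: `D.RGraph hS x y` says that
`y` is the value of `r_S` at `x`.
* `r_Id(x) = x`;
* `r_M(x)` is the point `c` with `{c} ∈ x`;
* `r_{S₁×S₂}(x) = (r_{S₁}([pr₁]⁻x), r_{S₂}([pr₂]⁻x))`;
* `r_{S₁+S₂}(x) = in_j(r_{S_j}([in_j]⁻x))`, for the index `j` with `¬[in_j]⊥ ∈ x`;
* `r_{Δ*S}(x)(A) = g_x(r_S⁻¹(A))` for every measurable `A ⊆ S(X_Id)`, where `g_x(|φ|)` is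
  `canonicalMeasure x φ`. -/
def RGraph : {S : UPoly ι} → S ∈ T.Ing → Set (Form M T S) →
    ((S.functor M).obj D.spaceId).carrier → Prop
  | .ident, _, x, y => (show D.spaceId.carrier from y).1 = x
  | .const i, _, x, y => Form.single (show (M i).carrier from y) ∈ x
  | .prod S₁ S₂, hS, x, y =>
      RGraph (UPoly.prod_left_mem hS) {φ | Form.pr₁ φ ∈ x}
        (show ((S₁.functor M).obj D.spaceId).carrier × ((S₂.functor M).obj D.spaceId).carrier
          from y).1 ∧
      RGraph (UPoly.prod_right_mem hS) {φ | Form.pr₂ φ ∈ x}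
        (show ((S₁.functor M).obj D.spaceId).carrier × ((S₂.functor M).obj D.spaceId).carrier
          from y).2
  | .sum S₁ S₂, hS, x, y =>
      Sum.elim
        (fun y₁ => (Form.in₁ Form.bot).neg ∈ x ∧
          RGraph (UPoly.sum_left_mem hS) {φ | Form.in₁ φ ∈ x} y₁)
        (fun y₂ => (Form.in₂ Form.bot).neg ∈ x ∧
          RGraph (UPoly.sum_right_mem hS) {φ | Form.in₂ φ ∈ x} y₂)
        (show ((S₁.functor M).obj D.spaceId).carrier ⊕ ((S₂.functor M).obj D.spaceId).carrier
          from y)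
  | .delta S, hS, x, y =>
      ∀ (A : ((S.functor M).obj D.spaceId).alg) (φ : Form M T S) (h : φ.Meas),
        {z : (D.space (UPoly.delta_mem hS)).carrier |
          ∃ w ∈ A.1, RGraph (UPoly.delta_mem hS) z.1 w} = D.ext (UPoly.delta_mem hS) φ →
        (show ((S.functor M).obj D.spaceId).delta.carrier from y).1 A = canonicalMeasure x φ h

end DeductionSystem

/-! Maximal sets of sort S are to be identified with points of S(X_Id). Outside the sorts Δ*S this
is Boolean bookkeeping; for Δ*S it must be shown that a maximal set x determines an upper
probability g_x.

For this it suffices to check the covering condition of Anger and Lembcke: if sets A_1, …, A_m cover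
U n+k times and the whole space k times, then n g(U) + k ≤ Σ g(A_i). Given this condition and a set
U, the Riesz extension theorem yields a finitely additive probability below g that agrees with g at
U (`CoverCondition.exists_finAddProb`), so g is the supremum of the probabilities below it. For g_x,
the Lindenbaum property makes every formula lying in all maximal sets provable (`Lindenbaum.prov`).
Hence a covering by sets |φ_i| is a provable statement, and the two covering rules turn it into the
inequality (`IsMaximal.coverCondition`). The archimedean rules ensure that [(p,q)]φ lies in x
exactly when g_x satisfies it (`IsMaximal.box_iff`).

Two facts carry the rest. The truth lemma `toPoint_mem_interp_iff` gives des_S ∘ r_S = id for the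
canonical coalgebra. For an arbitrary coalgebra, `toPoint_des` gives r_S ∘ des_S = S(des_Id). In the
canonical coalgebra des_Id is the identity, so the second fact makes r_S a two-sided inverse; at S =
T it says that des_Id is a coalgebra morphism. Uniqueness holds because morphisms preserve
descriptions and each canonical point is its own description. -/

/-! ### Set functions satisfying the covering condition are upper probabilities -/

namespace Unc

variable {X : Unc.{u}}

/-- The indicator function of a measurable set. -/
noncomputable def ind (U : X.alg) (x : X.carrier) : ℝ := U.1.indicator 1 x

theorem ind_mem_Icc (U : X.alg) (x : X.carrier) : ind U x ∈ Set.Icc (0 : ℝ) 1 := by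
  by_cases h : x ∈ U.1 <;> simp [ind, h]

/-- The covering condition of Anger and Lembcke: whenever the sets of the list `l` cover `U`
`n + k` times and the whole space `k` times, then `n * g U + k` is at most the sum of the
values of `g` on `l`. -/
def CoverCondition (X : Unc.{u}) (g : X.alg → ℝ) : Prop :=
  ∀ (l : List X.alg) (U : X.alg) (n k : ℕ),
    (∀ x, n * ind U x + k ≤ (l.map fun A => ind A x).sum) → n * g U + k ≤ (l.map g).sum

/-- Rounding each scaled coefficient up costs less than one per entry, so a real combination becomes
a list with repetitions at an error independent of `N`. -/
theorem sum_flatMap_replicate_ceil {α : Type*} (F : α → ℝ) (h0 : ∀ a, 0 ≤ F a) (h1 : ∀ a, F a ≤ 1)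
    (N : ℕ) (l : List (α × ℝ)) (hl : ∀ a ∈ l, 0 ≤ a.2) :
    N * (l.map fun a => a.2 * F a.1).sum ≤
        ((l.flatMap fun a => List.replicate ⌈(N : ℝ) * a.2⌉₊ a.1).map F).sum ∧
      ((l.flatMap fun a => List.replicate ⌈(N : ℝ) * a.2⌉₊ a.1).map F).sum ≤
        N * (l.map fun a => a.2 * F a.1).sum + l.length := by
  induction l with
  | nil => simp
  | cons a l ih =>
    obtain ⟨ih1, ih2⟩ := ih fun b hb => hl b (List.mem_cons_of_mem _ hb)
    have ha : 0 ≤ (N : ℝ) * a.2 := mul_nonneg N.cast_nonneg (hl a List.mem_cons_self)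
    have hc1 := mul_le_mul_of_nonneg_right (Nat.le_ceil ((N : ℝ) * a.2)) (h0 a.1)
    have hc2 := mul_le_mul_of_nonneg_right (Nat.ceil_lt_add_one ha).le (h0 a.1)
    have := h1 a.1
    simp only [List.map_cons, List.sum_cons, List.flatMap_cons, List.map_append, List.sum_append,
      List.map_replicate, List.sum_replicate, nsmul_eq_mul, List.length_cons, Nat.cast_add,
      Nat.cast_one]
    constructor <;> linarith

/-- The covering condition with real coefficients. -/
theorem CoverCondition.real {g : X.alg → ℝ} (hg : X.CoverCondition g) (h0 : ∀ U, 0 ≤ g U)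
    (h1 : ∀ U, g U ≤ 1) (l : List (X.alg × ℝ)) (hl : ∀ a ∈ l, 0 ≤ a.2) (U : X.alg) {t c : ℝ}
    (ht : 0 ≤ t) (hc : 0 ≤ c)
    (h : ∀ x, t * ind U x + c ≤ (l.map fun a => a.2 * ind a.1 x).sum) :
    t * g U + c ≤ (l.map fun a => a.2 * g a.1).sum := by
  -- The errors do not grow with `N`: rounding `N * t` and `N * c` down loses at most 1 each, whence
  -- the 2, and the ceilings add at most 1 per entry of `l`. Large `N` then gives the claim.
  have key : ∀ N : ℕ, N * (t * g U + c) - 2 ≤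
      N * (l.map fun a => a.2 * g a.1).sum + l.length := by
    intro N
    have hNt : 0 ≤ N * t := mul_nonneg N.cast_nonneg ht
    have hNc : 0 ≤ N * c := mul_nonneg N.cast_nonneg hc
    have hcov := hg (l.flatMap fun a => List.replicate ⌈(N : ℝ) * a.2⌉₊ a.1) U ⌊N * t⌋₊ ⌊N * c⌋₊ (by
      intro x
      refine le_trans ?_ (sum_flatMap_replicate_ceil (fun A => ind A x)
        (fun A => (ind_mem_Icc A x).1) (fun A => (ind_mem_Icc A x).2) N l hl).1
      have h2 := mul_le_mul_of_nonneg_left (h x) (N.cast_nonneg (α := ℝ))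
      have h3 := mul_le_mul_of_nonneg_right (Nat.floor_le hNt) (ind_mem_Icc U x).1
      have h4 := Nat.floor_le hNc
      linarith)
    have h2 := (sum_flatMap_replicate_ceil g h0 h1 N l hl).2
    have h3 := mul_le_mul_of_nonneg_right (Nat.lt_floor_add_one (N * t)).le (h0 U)
    have h4 := Nat.lt_floor_add_one (N * c)
    have h5 := h1 U
    linarith
  by_contra hlt
  push Not at hlt
  obtain ⟨N, hN⟩ := exists_nat_gt ((l.length + 2) /
    (t * g U + c - (l.map fun a => a.2 * g a.1).sum))
  rw [div_lt_iff₀ (by linarith)] at hN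
  have := key N
  linarith

/-! ### Dominated probabilities from the Riesz extension theorem -/

/-- The vector space of bounded functions. -/
def boundedFun (α : Type*) : Submodule ℝ (α → ℝ) where
  carrier := {f | ∃ C, ∀ x, |f x| ≤ C}
  zero_mem' := ⟨0, by simp⟩
  add_mem' := by
    rintro f g ⟨C, hC⟩ ⟨C', hC'⟩
    exact ⟨C + C', fun x => (abs_add_le _ _).trans (add_le_add (hC x) (hC' x))⟩
  smul_mem' := by
    rintro a f ⟨C, hC⟩
    refine ⟨|a| * C, fun x => ?_⟩
    rw [Pi.smul_apply, smul_eq_mul, abs_mul]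
    exact mul_le_mul_of_nonneg_left (hC x) (abs_nonneg a)

/-- The indicator function of a measurable set as a bounded function. -/
noncomputable def bind (U : X.alg) : boundedFun X.carrier :=
  ⟨ind U, 1, fun x => abs_le.2 ⟨by linarith [(ind_mem_Icc U x).1], (ind_mem_Icc U x).2⟩⟩

/-- The constant function one as a bounded function. -/
def bone (α : Type*) : boundedFun α := ⟨1, 1, by simp⟩

theorem sum_map_mul_left {α : Type*} (l : List (α × ℝ)) (F : α → ℝ) (a : ℝ) :
    ((l.map fun b => (b.1, a * b.2)).map fun b => b.2 * F b.1).sum =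
      a * (l.map fun b => b.2 * F b.1).sum := by
  induction l with
  | nil => simp
  | cons b l ih => simp only [List.map_cons, List.sum_cons, ih]; ring

/-- The cone of the bounded functions on which every finitely additive probability measure below
`g` that agrees with `g` at `U` must be nonnegative. -/
def supportCone (g : X.alg → ℝ) (U : X.alg) : ConvexCone ℝ (boundedFun X.carrier) where
  carrier := {h | ∃ (l : List (X.alg × ℝ)) (t : ℝ), (∀ a ∈ l, 0 ≤ a.2) ∧ 0 ≤ t ∧
    ∀ x, (l.map fun a => a.2 * (g a.1 - ind a.1 x)).sum + t * (ind U x - g U) ≤ h.1 x}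
  smul_mem' := by
    rintro a ha h ⟨l, t, hl, ht, hx⟩
    refine ⟨l.map fun b => (b.1, a * b.2), a * t, ?_, by positivity, fun x => ?_⟩
    · intro b hb
      obtain ⟨b', hb', rfl⟩ := List.mem_map.1 hb
      exact mul_nonneg ha.le (hl b' hb')
    · rw [sum_map_mul_left l (fun A => g A - ind A x)]
      have := mul_le_mul_of_nonneg_left (hx x) ha.le
      change _ ≤ a * h.1 x
      linarith
  add_mem' := by
    rintro h ⟨l, t, hl, ht, hx⟩ h' ⟨l', t', hl', ht', hx'⟩
    refine ⟨l ++ l', t + t', ?_, by positivity, fun x => ?_⟩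
    · intro b hb
      rcases List.mem_append.1 hb with hb | hb
      exacts [hl b hb, hl' b hb]
    · rw [List.map_append, List.sum_append]
      have h1 := hx x
      have h2 := hx' x
      change _ ≤ h.1 x + h'.1 x
      linarith

/-- This is consistency of the constraints collected in the cone: on the constants they only ask for
what the functional a·1 ↦ a satisfies. It is the positivity hypothesis of the Riesz extension. -/
theorem CoverCondition.const_nonneg {g : X.alg → ℝ} (hg : X.CoverCondition g)
    (h0 : ∀ U, 0 ≤ g U) (h1 : ∀ U, g U ≤ 1) (U : X.alg) {a : ℝ}
    (ha : a • bone X.carrier ∈ supportCone g U) : 0 ≤ a := by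
  obtain ⟨l, t, hl, ht, hx⟩ := ha
  have hsplit : ∀ x, (l.map fun a => a.2 * (g a.1 - ind a.1 x)).sum =
      (l.map fun a => a.2 * g a.1).sum - (l.map fun a => a.2 * ind a.1 x).sum := by
    intro x
    clear hl hx
    induction l with
    | nil => simp
    | cons b l ih => simp only [List.map_cons, List.sum_cons, ih]; ring
  have hx' : ∀ x, t * ind U x + ((l.map fun a => a.2 * g a.1).sum - t * g U - a) ≤
      (l.map fun a => a.2 * ind a.1 x).sum := by
    intro x
    have h2 := hx x
    rw [hsplit x] at h2
    have h3 : (a • bone X.carrier).1 x = a := by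
      change a * 1 = a
      ring
    rw [h3] at h2
    linarith
  -- The covering condition needs a nonnegative constant. A negative one is moved to the other side
  -- as a coefficient of the whole space, where `g` is at most 1.
  rcases le_total 0 ((l.map fun a => a.2 * g a.1).sum - t * g U - a) with hc | hc
  · have := hg.real h0 h1 l hl U ht hc hx'
    linarith
  · have := hg.real h0 h1 ((⟨Set.univ, X.isAlg.univ_mem⟩,
      -((l.map fun a => a.2 * g a.1).sum - t * g U - a)) :: l) (by
        intro b hb
        rcases List.mem_cons.1 hb with rfl | hb
        · simpa using hc
        · exact hl b hb) U ht le_rfl (by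
        intro x
        have h2 := hx' x
        simp only [List.map_cons, List.sum_cons]
        have h3 : ind (⟨Set.univ, X.isAlg.univ_mem⟩ : X.alg) x = 1 := by simp [ind]
        rw [h3]
        linarith)
    simp only [List.map_cons, List.sum_cons] at this
    have h3 := mul_le_mul_of_nonneg_left (h1 ⟨Set.univ, X.isAlg.univ_mem⟩)
      (neg_nonneg.2 hc)
    linarith

theorem CoverCondition.empty {g : X.alg → ℝ} (hg : X.CoverCondition g) (h0 : ∀ U, 0 ≤ g U) :
    g ⟨∅, X.isAlg.empty_mem⟩ = 0 := by
  have := hg [] ⟨∅, X.isAlg.empty_mem⟩ 1 0 (by simp [ind])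
  exact le_antisymm (by simpa using this) (h0 _)

theorem CoverCondition.univ {g : X.alg → ℝ} (hg : X.CoverCondition g) (h0 : ∀ U, 0 ≤ g U)
    (h1 : ∀ U, g U ≤ 1) : g ⟨Set.univ, X.isAlg.univ_mem⟩ = 1 := by
  -- Only `k = 1` matters here; the term with `n` vanishes because `g` is 0 at the empty set.
  have := hg [⟨Set.univ, X.isAlg.univ_mem⟩] ⟨∅, X.isAlg.empty_mem⟩ 1 1 (by simp [ind])
  rw [hg.empty h0] at this
  exact le_antisymm (h1 _) (by simpa using this)

theorem mem_supportCone_of_nonneg {g : X.alg → ℝ} {U : X.alg} {h : boundedFun X.carrier}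
    (hh : ∀ x, 0 ≤ h.1 x) : h ∈ supportCone g U :=
  ⟨[], 0, by simp, le_rfl, fun x => by simpa using hh x⟩

/-- A set function satisfying the covering condition dominates a finitely additive probability
measure that agrees with it at a given set. -/
theorem CoverCondition.exists_finAddProb {g : X.alg → ℝ} (hg : X.CoverCondition g)
    (h0 : ∀ U, 0 ≤ g U) (h1 : ∀ U, g U ≤ 1) (U : X.alg) :
    ∃ μ, X.IsFinAddProb μ ∧ (∀ A, μ A ≤ g A) ∧ μ U = g U := by
  -- The space is nonempty, since `g` separates ∅ from the whole space; hence a·1 ↦ a is well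
  -- defined on the constants.
  have hne : bone X.carrier ≠ 0 := by
    intro h
    have hempty : (∅ : Set X.carrier) = Set.univ := by
      refine Set.eq_of_subset_of_subset (Set.empty_subset _) fun x _ => ?_
      have := congrFun (congrArg Subtype.val h) x
      exact (one_ne_zero (α := ℝ) this).elim
    have e0 := hg.empty h0
    have e1 := hg.univ h0 h1
    simp only [← hempty] at e1
    exact zero_ne_one (e0.symm.trans e1)
  -- Extend a·1 ↦ a to all bounded functions. The last hypothesis of the theorem holds because a
  -- function bounded by `C` becomes nonnegative after adding `C`.
  obtain ⟨L, hLf, hL⟩ := riesz_extension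
    ((supportCone g U).toPointedCone (mem_supportCone_of_nonneg fun _ => le_rfl))
    (LinearPMap.mkSpanSingleton' (σ := RingHom.id ℝ) (bone X.carrier) (1 : ℝ)
      fun c hc => by simpa [hne] using hc) (by
      rintro ⟨x, hx⟩ hs
      obtain ⟨a, rfl⟩ := Submodule.mem_span_singleton.1 hx
      rw [LinearPMap.mkSpanSingleton'_apply]
      simpa using hg.const_nonneg h0 h1 U hs) (by
      rintro ⟨y, C, hC⟩
      refine ⟨⟨C • bone X.carrier, Submodule.mem_span_singleton.2 ⟨C, rfl⟩⟩,
        mem_supportCone_of_nonneg fun x => ?_⟩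
      change 0 ≤ C * 1 + y x
      linarith [neg_abs_le (y x), hC x])
  have hone : L (bone X.carrier) = 1 :=
    (hLf ⟨bone X.carrier, Submodule.mem_span_singleton_self _⟩).trans
      (LinearPMap.mkSpanSingleton'_apply_self _ _ _ _)
  -- The cone contains g(A)·1 − 1_A, which forces domination by `g`.
  have hle : ∀ A : X.alg, L (bind A) ≤ g A := by
    intro A
    have := hL (g A • bone X.carrier - bind A) ⟨[(A, 1)], 0, by simp, le_rfl, fun x => by
      change _ ≤ g A * 1 - ind A x
      simp⟩
    rw [map_sub, map_smul, hone] at this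
    simpa using this
  have hnn : ∀ A : X.alg, 0 ≤ L (bind A) := fun A =>
    hL _ (mem_supportCone_of_nonneg fun x => (ind_mem_Icc A x).1)
  refine ⟨fun A => L (bind A), ⟨fun A => ⟨hnn A, (hle A).trans (h1 A)⟩, ?_, ?_, ?_⟩, hle, ?_⟩
  · exact le_antisymm ((hle _).trans (hg.empty h0).le) (hnn _)
  · rw [← hone]
    congr 1
    refine Subtype.ext (funext fun x => ?_)
    change ind _ x = 1
    simp [ind]
  · intro A B hAB
    rw [← map_add]
    congr 1
    refine Subtype.ext (funext fun x => ?_)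
    change ind _ x = ind A x + ind B x
    exact congrFun (Set.indicator_union_of_disjoint hAB 1) x
  · refine le_antisymm (hle U) ?_
    -- The generator 1_U − g(U)·1 of the cone forces the reverse inequality at `U`.
    have := hL (bind U - g U • bone X.carrier) ⟨[], 1, by simp, zero_le_one, fun x => by
      change _ ≤ ind U x - g U * 1
      simp⟩
    rw [map_sub, map_smul, hone] at this
    simpa using this

/-- Set functions with values in `[0,1]` satisfying the covering condition are upper
probabilities. -/
theorem CoverCondition.isUpperProb {g : X.alg → ℝ} (hg : X.CoverCondition g)
    (h0 : ∀ U, 0 ≤ g U) (h1 : ∀ U, g U ≤ 1) : X.IsUpperProb g := by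
  refine ⟨{μ | X.IsFinAddProb μ ∧ ∀ A, μ A ≤ g A}, ?_, fun μ hμ => hμ.1, fun U => ⟨?_, ?_⟩⟩
  · obtain ⟨μ, h, hle, -⟩ := hg.exists_finAddProb h0 h1 ⟨∅, X.isAlg.empty_mem⟩
    exact ⟨μ, h, hle⟩
  · rintro _ ⟨μ, hμ, rfl⟩
    exact hμ.2 U
  · intro b hb
    obtain ⟨μ, h, hle, hU⟩ := hg.exists_finAddProb h0 h1 U
    exact hU ▸ hb ⟨μ, ⟨h, hle⟩, rfl⟩

/-- Upper probabilities take values in `[0,1]`. -/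
theorem IsUpperProb.mem_Icc {g : X.alg → ℝ} (hg : X.IsUpperProb g) (U : X.alg) :
    g U ∈ Set.Icc (0 : ℝ) 1 := by
  obtain ⟨P, ⟨μ, hμ⟩, hP, hlub⟩ := hg
  refine ⟨((hP μ hμ).mem_Icc U).1.trans ((hlub U).1 ⟨μ, hμ, rfl⟩), (hlub U).2 ?_⟩
  rintro _ ⟨ν, hν, rfl⟩
  exact ((hP ν hν).mem_Icc U).2

end Unc

section MaximalSets

variable {ι : Type u} {M : ι → Unc.{u}} {T : UPoly ι}

/-! ### Maximal sets -/

namespace Form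

variable {S : UPoly ι}

theorem Meas.or {φ ψ : Form M T S} (hφ : φ.Meas) (hψ : ψ.Meas) : (φ.or ψ).Meas := hφ.neg.imp hψ

theorem Meas.and {φ ψ : Form M T S} (hφ : φ.Meas) (hψ : ψ.Meas) : (φ.and ψ).Meas :=
  (hφ.neg.or hψ.neg).neg

end Form

namespace DeductionSystem

variable {D : DeductionSystem M T}

namespace IsMaximal

variable {S : UPoly ι} {hS : S ∈ T.Ing} {x : Set (Form M T S)}

theorem ax (hx : D.IsMaximal hS x) {φ : Form M T S} (h : Ax M T φ) : φ ∈ x :=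
  hx.closed (D.assumption hS _ _ (Or.inr h))

theorem theorem_mem (hx : D.IsMaximal hS x) {φ : Form M T S} (h : D.Prov hS ∅ φ) : φ ∈ x :=
  hx.closed (D.cut hS _ _ _ (fun _ h => h.elim) h)

theorem closed_of_forall_mem (hx : D.IsMaximal hS x) {Γ : Set (Form M T S)} {φ : Form M T S}
    (h : D.Prov hS Γ φ) (hΓ : ∀ ψ ∈ Γ, ψ ∈ x) : φ ∈ x :=
  hx.closed (D.cut hS _ _ _ (fun ψ hψ => D.assumption hS _ _ (Or.inl (hΓ ψ hψ))) h)

theorem bot_notMem (hx : D.IsMaximal hS x) : Form.bot ∉ x :=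
  fun h => hx.2 (D.assumption hS _ _ (Or.inl h))

theorem neg_iff (hx : D.IsMaximal hS x) (φ : Form M T S) : φ.neg ∈ x ↔ φ ∉ x := by
  have := hx.1 φ
  tauto

theorem or_iff (hx : D.IsMaximal hS x) (φ ψ : Form M T S) : φ.or ψ ∈ x ↔ φ ∈ x ∨ ψ ∈ x := by
  rw [Form.or, hx.imp_iff, hx.neg_iff]
  tauto

theorem and_iff (hx : D.IsMaximal hS x) (φ ψ : Form M T S) : φ.and ψ ∈ x ↔ φ ∈ x ∧ ψ ∈ x := by
  rw [Form.and, hx.neg_iff, hx.or_iff, hx.neg_iff, hx.neg_iff]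
  tauto

theorem iff_iff (hx : D.IsMaximal hS x) (φ ψ : Form M T S) :
    φ.iff ψ ∈ x ↔ (φ ∈ x ↔ ψ ∈ x) := by
  rw [Form.iff, hx.and_iff, hx.imp_iff, hx.imp_iff]
  tauto

theorem bigAnd_iff (hx : D.IsMaximal hS x) (l : List (Form M T S)) :
    Form.bigAnd l ∈ x ↔ ∀ φ ∈ l, φ ∈ x := by
  induction l with
  | nil =>
    change Form.bot.neg ∈ x ↔ _
    simp [hx.neg_iff, hx.bot_notMem]
  | cons φ l ih =>
    change φ.and (Form.bigAnd l) ∈ x ↔ _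
    simp [hx.and_iff, ih]

theorem bigOr_iff (hx : D.IsMaximal hS x) (l : List (Form M T S)) :
    Form.bigOr l ∈ x ↔ ∃ φ ∈ l, φ ∈ x := by
  induction l with
  | nil =>
    change Form.bot ∈ x ↔ _
    simp [hx.bot_notMem]
  | cons φ l ih =>
    change φ.or (Form.bigOr l) ∈ x ↔ _
    simp [hx.or_iff, ih]

open Classical in
theorem atLeast_iff (hx : D.IsMaximal hS x) {m : ℕ} (k : ℕ) (φ : Fin m → Form M T S) :
    Form.atLeast k φ ∈ x ↔ k ≤ (Finset.univ.filter fun i => φ i ∈ x).card := by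
  rw [Form.atLeast, hx.bigOr_iff]
  simp only [List.mem_map, Finset.mem_toList, Finset.mem_powersetCard, Finset.subset_univ,
    true_and, exists_exists_and_eq_and, hx.bigAnd_iff, forall_exists_index, and_imp,
    forall_apply_eq_imp_iff₂]
  constructor
  · rintro ⟨I, rfl, hI⟩
    exact Finset.card_le_card fun i hi => by simpa using hI i hi
  · intro h
    obtain ⟨I, hI, hk⟩ := Finset.exists_subset_card_eq h
    exact ⟨I, hk, fun i hi => by simpa using hI hi⟩

/-- Maximal sets pull back along a modality that commutes with negation and preserves
deduction. -/
theorem preimage {S' : UPoly ι} {hS' : S' ∈ T.Ing} (hx : D.IsMaximal hS x)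
    (κ : Form M T S' → Form M T S)
    (hneg : ∀ φ, (κ φ).neg ∈ x → κ φ.neg ∈ x) (hbot : κ Form.bot ∉ x)
    (hκ : ∀ Γ ψ, D.Prov hS' Γ ψ → D.Prov hS (κ '' Γ) (κ ψ)) : D.IsMaximal hS' {φ | κ φ ∈ x} := by
  have hmp : ∀ (Γ : Set (Form M T S')) (ψ : Form M T S'), (∀ θ ∈ Γ, κ θ ∈ x) →
      D.Prov hS' Γ ψ → κ ψ ∈ x := by
    intro Γ ψ hΓ h
    refine hx.closed_of_forall_mem (hκ Γ ψ h) ?_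
    rintro _ ⟨θ, hθ, rfl⟩
    exact hΓ θ hθ
  refine ⟨fun φ => ⟨fun h h' => hbot ?_, fun h => ?_⟩, fun h => hbot (hmp _ _ (fun _ h => h) h)⟩
  · refine hmp {φ, φ.imp Form.bot} _ ?_ (D.modusPonens _ φ Form.bot)
    rintro θ (rfl | rfl)
    exacts [h, h']
  · exact (hx.1 _).2 fun hn => h (hneg φ hn)

end IsMaximal

/-- In a Lindenbaum system the formulas contained in all maximal sets are provable. -/
theorem Lindenbaum.prov (hL : D.Lindenbaum) {S : UPoly ι} (hS : S ∈ T.Ing) {φ : Form M T S}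
    (h : ∀ x, D.IsMaximal hS x → φ ∈ x) : D.Prov hS ∅ φ := by
  by_contra hφ
  -- If ¬φ were inconsistent, the deduction rule would give ¬¬φ and a tautology φ; so ¬φ lies in
  -- some maximal set.
  obtain ⟨x, hx, hsub⟩ := hL hS {φ.neg} fun hbot => hφ (by
    have h1 : D.Prov hS ∅ (φ.neg.imp Form.bot) := by
      refine D.deduction hS _ _ _ ?_
      rwa [Set.empty_union]
    refine D.cut hS ∅ {φ.neg.imp Form.bot, (φ.neg.imp Form.bot).imp φ} _ ?_ (D.modusPonens hS _ _)
    rintro ψ (rfl | rfl)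
    · exact h1
    · refine D.assumption hS _ _ (Or.inr (.tautology _ fun v hb hv => ?_))
      simp only [hv, Form.neg]
      tauto)
  exact (hx.neg_iff φ).1 (hsub rfl) (h x hx)

/-! ### The canonical upper probability of a maximal set -/

section Canonical

variable {S : UPoly ι} {hS : S.delta ∈ T.Ing} {x : Set (Form M T S.delta)}

/-- If the upper value is not at least p, it is below p, hence at most p, hence below q; the two
comparison axioms express these steps. -/
theorem IsMaximal.upperGe_antitone (hx : D.IsMaximal hS x) {φ : Form M T S} (h : φ.Meas)
    {p q : unitInterval} (hpq : p < q) (hq : Form.upperGe q φ h ∈ x) : Form.upperGe p φ h ∈ x := by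
  by_contra hp
  have h1 := (hx.imp_iff _ _).1 (hx.ax (.upperLt_upperLe p φ h)) ((hx.neg_iff _).2 hp)
  have h2 := (hx.imp_iff _ _).1 (hx.ax (.upperLe_upperLt p q φ h hpq)) h1
  exact (hx.neg_iff _).1 h2 hq

theorem bddAbove_upperGe (x : Set (Form M T S.delta)) (φ : Form M T S) (h : φ.Meas) :
    BddAbove {r : ℝ | ∃ q : unitInterval, r = q ∧ Form.upperGe q φ h ∈ x} :=
  ⟨1, by rintro _ ⟨q, rfl, -⟩; exact q.2.2⟩

theorem canonicalMeasure_mem_Icc (x : Set (Form M T S.delta)) (φ : Form M T S) (h : φ.Meas) :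
    canonicalMeasure x φ h ∈ Set.Icc (0 : ℝ) 1 :=
  ⟨Real.sSup_nonneg (by rintro _ ⟨q, rfl, -⟩; exact q.2.1),
    Real.sSup_le (by rintro _ ⟨q, rfl, -⟩; exact q.2.2) zero_le_one⟩

/-- The infinitary archimedean rule makes the supremum attained, so the single number g_x(φ) encodes
all the formulas u_{≥q}φ in x. -/
theorem IsMaximal.upperGe_iff (hx : D.IsMaximal hS x) {φ : Form M T S} (h : φ.Meas)
    (q : unitInterval) : Form.upperGe q φ h ∈ x ↔ (q : ℝ) ≤ canonicalMeasure x φ h := by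
  refine ⟨fun hq => le_csSup (bddAbove_upperGe x φ h) ⟨q, rfl, hq⟩, fun hq => ?_⟩
  refine hx.closed_of_forall_mem (D.archimedean_upper hS q φ h) ?_
  rintro _ ⟨p, hp, rfl⟩
  have hp' : (p : ℝ) < canonicalMeasure x φ h := lt_of_lt_of_le hp hq
  -- The real supremum of the empty set is 0, which cannot exceed `p ≥ 0`.
  have hne : {r : ℝ | ∃ q : unitInterval, r = q ∧ Form.upperGe q φ h ∈ x}.Nonempty := by
    by_contra hne
    rw [Set.not_nonempty_iff_eq_empty] at hne
    rw [canonicalMeasure, hne, Real.sSup_empty] at hp'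
    exact hp'.not_ge p.2.1
  obtain ⟨_, ⟨q', rfl, hq'⟩, hlt⟩ := exists_lt_of_lt_csSup hne hp'
  exact hx.upperGe_antitone h hlt hq'

theorem IsMaximal.upperLe_iff (hx : D.IsMaximal hS x) {φ : Form M T S} (h : φ.Meas)
    (p : unitInterval) : Form.upperLe p φ h ∈ x ↔ canonicalMeasure x φ h ≤ p := by
  have hlt : ∀ q r : unitInterval, q < r → Form.upperLe q φ h ∈ x →
      canonicalMeasure x φ h < r := by
    intro q r hqr hq
    have := (hx.imp_iff _ _).1 (hx.ax (.upperLe_upperLt q r φ h hqr)) hq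
    rw [Form.upperLt, hx.neg_iff, hx.upperGe_iff] at this
    exact not_le.1 this
  constructor
  · intro hp
    refine le_of_not_gt fun hgt => ?_
    -- The threshold `r` is the canonical value itself, which would then be smaller than itself.
    exact lt_irrefl _ (hlt p ⟨_, canonicalMeasure_mem_Icc x φ h⟩ hgt hp)
  · intro hp
    -- By definition u_{≤p}φ is l_{≥1−p}¬φ, so the lower archimedean rule applies. Each q < 1−p
    -- leaves room for a strict bound g_x(φ) < 1−q, which the axioms weaken to u_{≤1−q}φ.
    refine hx.closed_of_forall_mem
      (D.archimedean_lower hS (unitInterval.symm p) φ.neg h.neg) ?_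
    rintro _ ⟨q, hq, rfl⟩
    have h1 : Form.upperLt (unitInterval.symm q) φ h ∈ x := by
      rw [Form.upperLt, hx.neg_iff, hx.upperGe_iff]
      have hq' : (q : ℝ) < 1 - p := hq
      have : ((unitInterval.symm q : unitInterval) : ℝ) = 1 - q := rfl
      rw [this]
      linarith
    have h2 := (hx.imp_iff _ _).1 (hx.ax (.upperLt_upperLe _ φ h)) h1
    rw [Form.upperLe, unitInterval.symm_symm] at h2
    exact h2

theorem IsMaximal.lowerGe_iff (hx : D.IsMaximal hS x) {φ : Form M T S} (h : φ.Meas)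
    (q : unitInterval) :
    Form.lowerGe q φ h ∈ x ↔ (q : ℝ) ≤ 1 - canonicalMeasure x φ.neg h.neg := by
  rw [(hx.iff_iff _ _).1 (hx.ax (.duality q φ h)), hx.upperLe_iff]
  change _ ≤ 1 - (q : ℝ) ↔ _
  exact le_sub_comm

theorem IsMaximal.box_iff (hx : D.IsMaximal hS x) {φ : Form M T S} (h : φ.Meas)
    (p q : unitInterval) :
    Form.box p q φ h ∈ x ↔
      (p : ℝ) ≤ canonicalMeasure x φ h ∧ (q : ℝ) ≤ 1 - canonicalMeasure x φ.neg h.neg := by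
  rw [(hx.iff_iff _ _).1 (hx.ax (.box_iff p q φ h)), hx.and_iff, hx.upperGe_iff, hx.lowerGe_iff]

/-- By completeness the inclusion is a provable implication. Necessitation puts l_{≥1}(φ → ψ) into
x, and the monotonicity axiom is used at the level g_x(φ). -/
theorem IsMaximal.canonicalMeasure_mono (hL : D.Lindenbaum) (hx : D.IsMaximal hS x)
    {φ ψ : Form M T S} (hφ : φ.Meas) (hψ : ψ.Meas)
    (h : D.ext (UPoly.delta_mem hS) φ ⊆ D.ext (UPoly.delta_mem hS) ψ) :
    canonicalMeasure x φ hφ ≤ canonicalMeasure x ψ hψ := by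
  have hprov : D.Prov (UPoly.delta_mem hS) ∅ (φ.imp ψ) :=
    hL.prov _ fun y hy => (hy.imp_iff _ _).2 fun hm => h (show ⟨y, hy⟩ ∈ D.ext _ φ from hm)
  have h1 := hx.theorem_mem (D.necessitation hS _ (hφ.imp hψ) hprov)
  have h2 := (hx.imp_iff _ _).1 (hx.ax
    (.upperGe_mono ⟨_, canonicalMeasure_mem_Icc x φ hφ⟩ φ ψ hφ hψ)) h1
  exact (hx.upperGe_iff _ _).1 ((hx.imp_iff _ _).1 h2 ((hx.upperGe_iff _ _).2 le_rfl))

/-- This makes g_x a function of the set |φ| and the choice of a defining formula harmless. -/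
theorem IsMaximal.canonicalMeasure_congr (hL : D.Lindenbaum) (hx : D.IsMaximal hS x)
    {φ ψ : Form M T S} (hφ : φ.Meas) (hψ : ψ.Meas)
    (h : D.ext (UPoly.delta_mem hS) φ = D.ext (UPoly.delta_mem hS) ψ) :
    canonicalMeasure x φ hφ = canonicalMeasure x ψ hψ :=
  le_antisymm (hx.canonicalMeasure_mono hL hφ hψ h.subset)
    (hx.canonicalMeasure_mono hL hψ hφ h.superset)

variable (D) in
/-- A measurable formula defining a given measurable set of maximal sets. -/
noncomputable def formOf {S : UPoly ι} {hS : S ∈ T.Ing} (A : (D.space hS).alg) : Form M T S :=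
  A.2.choose

theorem formOf_meas {S : UPoly ι} {hS : S ∈ T.Ing} (A : (D.space hS).alg) : (D.formOf A).Meas :=
  A.2.choose_spec.1

theorem ext_formOf {S : UPoly ι} {hS : S ∈ T.Ing} (A : (D.space hS).alg) :
    D.ext hS (D.formOf A) = A.1 :=
  A.2.choose_spec.2.symm

/-- The set function `g_x` on the algebra of the space of maximal sets. -/
noncomputable def canonicalFun (hS : S.delta ∈ T.Ing) (x : Set (Form M T S.delta))
    (A : (D.space (UPoly.delta_mem hS)).alg) : ℝ :=
  canonicalMeasure x (D.formOf A) (formOf_meas A)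

theorem IsMaximal.canonicalFun_eq (hL : D.Lindenbaum) (hx : D.IsMaximal hS x)
    (A : (D.space (UPoly.delta_mem hS)).alg) {φ : Form M T S} (hφ : φ.Meas)
    (h : A.1 = D.ext (UPoly.delta_mem hS) φ) :
    canonicalFun hS x A = canonicalMeasure x φ hφ :=
  hx.canonicalMeasure_congr hL _ _ ((ext_formOf A).trans h)

-- The multiplicity of a cover at `y` is a count of formulas in `y`, the quantity that
-- `Form.atLeast` expresses.
open Classical in
theorem sum_ind_eq_card (l : List (D.space (UPoly.delta_mem hS)).alg)
    (y : (D.space (UPoly.delta_mem hS)).carrier) :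
    (l.map fun A => Unc.ind A y).sum =
      ((Finset.univ.filter fun i : Fin l.length => D.formOf l[i] ∈ y.1).card : ℝ) := by
  have hind : ∀ A : (D.space (UPoly.delta_mem hS)).alg,
      Unc.ind A y = if D.formOf A ∈ y.1 then 1 else 0 := by
    intro A
    have : y ∈ A.1 ↔ D.formOf A ∈ y.1 := by rw [← ext_formOf A]; rfl
    by_cases h : y ∈ A.1
    · simp [Unc.ind, h, this.1 h]
    · simp [Unc.ind, h, mt this.2 h]
  rw [Finset.card_filter, Nat.cast_sum, ← Fin.sum_univ_fun_getElem]
  exact Finset.sum_congr rfl fun i _ => by simp [hind]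

/-- Both covering hypotheses hold at every maximal set, hence are provable, and the covering rules
apply with the p_i equal to the canonical values of the φ_i. All the premises u_{≤p_i}φ_i then lie
in x. -/
theorem IsMaximal.coverCondition (hL : D.Lindenbaum) (hx : D.IsMaximal hS x) :
    (D.space (UPoly.delta_mem hS)).CoverCondition (canonicalFun hS x) := by
  classical
  intro l U n k hcov
  let φs : Fin l.length → Form M T S := fun i => D.formOf l[i]
  let ps : Fin l.length → unitInterval := fun i => ⟨_, canonicalMeasure_mem_Icc x (φs i)
    (formOf_meas _)⟩
  have hsum : (l.map (canonicalFun hS x)).sum = ∑ i, (ps i : ℝ) := by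
    rw [← Fin.sum_univ_fun_getElem]
    rfl
  have hand : Form.bigAnd (List.ofFn fun i => Form.upperLe (ps i) (φs i) (formOf_meas _)) ∈ x := by
    rw [hx.bigAnd_iff]
    intro θ hθ
    obtain ⟨i, rfl⟩ := List.mem_ofFn.1 hθ
    exact (hx.upperLe_iff _ _).2 le_rfl
  have hind0 : ∀ y, 0 ≤ n * Unc.ind U y := fun y =>
    mul_nonneg n.cast_nonneg (Unc.ind_mem_Icc U y).1
  have hk : D.Prov (UPoly.delta_mem hS) ∅ (Form.atLeast k φs) := by
    refine hL.prov _ fun y hy => (hy.atLeast_iff _ _).2 ?_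
    have h1 := (hcov ⟨y, hy⟩).trans_eq (sum_ind_eq_card (hS := hS) l ⟨y, hy⟩)
    have h2 := hind0 ⟨y, hy⟩
    exact_mod_cast (le_add_of_nonneg_left h2).trans h1
  -- This settles `n = 0`. For `n > 0` it makes the quotient in the rule nonnegative, so truncation
  -- to [0,1] cannot raise it.
  have hle : (k : ℝ) ≤ ∑ i, (ps i : ℝ) := by
    by_contra hlt
    have := hx.theorem_mem (D.cover_zero hS _ k φs (fun _ => formOf_meas _) ps hk (not_le.1 hlt))
    exact (hx.neg_iff _).1 this hand
  rw [hsum]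
  rcases Nat.eq_zero_or_pos n with rfl | hn
  · simpa using hle
  have hnk : D.Prov (UPoly.delta_mem hS) ∅ ((D.formOf U).imp (Form.atLeast (n + k) φs)) := by
    refine hL.prov _ fun y hy => (hy.imp_iff _ _).2 fun hU => (hy.atLeast_iff _ _).2 ?_
    have h1 := (hcov ⟨y, hy⟩).trans_eq (sum_ind_eq_card (hS := hS) l ⟨y, hy⟩)
    have hy' : (⟨y, hy⟩ : (D.space (UPoly.delta_mem hS)).carrier) ∈ U.1 := by
      rw [← ext_formOf U]
      exact hU
    have h2 : Unc.ind U ⟨y, hy⟩ = 1 := Set.indicator_of_mem hy' 1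
    rw [h2, mul_one] at h1
    exact_mod_cast h1
  have hn' : (0 : ℝ) < n := by exact_mod_cast hn
  have hq0 : 0 ≤ (∑ i, (ps i : ℝ) - k) / n := div_nonneg (sub_nonneg.2 hle) hn'.le
  have hmem := hx.theorem_mem (D.cover_pos hS _ n k (D.formOf U) (formOf_meas U) φs
    (fun _ => formOf_meas _) ps
    ⟨max 0 (min 1 ((∑ i, (ps i : ℝ) - k) / n)), le_max_left _ _,
      max_le zero_le_one (min_le_left _ _)⟩ hn hnk hk rfl)
  have hfin := (hx.upperLe_iff _ _).1 ((hx.imp_iff _ _).1 hmem hand)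
  have hfin' : canonicalFun hS x U ≤ (∑ i, (ps i : ℝ) - k) / n :=
    hfin.trans (max_le hq0 (min_le_right _ _))
  rw [le_div_iff₀ hn'] at hfin'
  linarith

theorem IsMaximal.isUpperProb (hL : D.Lindenbaum) (hx : D.IsMaximal hS x) :
    (D.space (UPoly.delta_mem hS)).IsUpperProb (canonicalFun hS x) :=
  (hx.coverCondition hL).isUpperProb (fun _ => (canonicalMeasure_mem_Icc x _ _).1)
    (fun _ => (canonicalMeasure_mem_Icc x _ _).2)

end Canonical

end DeductionSystem

/-! ### Description maps -/

theorem Set.inl_mem_image_union_range {α β : Type*} {a : α} {s : Set α} :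
    (Sum.inl a : α ⊕ β) ∈ Sum.inl '' s ∪ Set.range Sum.inr ↔ a ∈ s := by simp

theorem Set.inr_mem_range_union_image {α β : Type*} {b : β} {s : Set β} :
    (Sum.inr b : α ⊕ β) ∈ Set.range Sum.inl ∪ Sum.inr '' s ↔ b ∈ s := by simp

/-- This makes the measurability proviso in the interpretation of `box` automatic and yields the
measurability of the description maps. -/
theorem RawForm.interp_mem_alg (Y : TCoalg M T) {S : UPoly ι} (φ : RawForm M T S) (h : φ.Meas) :
    φ.interp Y ∈ ((S.functor M).obj Y.V).alg := by
  induction φ with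
  | bot => exact Unc.isAlg _ |>.empty_mem
  | imp φ ψ ih₁ ih₂ =>
    exact (Unc.isAlg _).union_mem ((Unc.isAlg _).compl_mem (ih₁ h.1)) (ih₂ h.2)
  | atom A => exact h
  | pr₁ φ ih =>
    exact .base _ ⟨_, ih h, Set.univ, (Unc.isAlg _).univ_mem, by rw [Set.prod_univ]; rfl⟩
  | pr₂ φ ih =>
    exact .base _ ⟨Set.univ, (Unc.isAlg _).univ_mem, _, ih h, by rw [Set.univ_prod]; rfl⟩
  | in₁ φ ih =>
    exact .union _ _ (.base _ (Or.inl ⟨_, ih h, rfl⟩))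
      (.base _ (Or.inr ⟨Set.univ, (Unc.isAlg _).univ_mem, by rw [Set.image_univ]⟩))
  | in₂ φ ih =>
    exact .union _ _ (.base _ (Or.inl ⟨Set.univ, (Unc.isAlg _).univ_mem, by rw [Set.image_univ]⟩))
      (.base _ (Or.inr ⟨_, ih h, rfl⟩))
  | next φ ih => exact Unc.fn_meas Y.str (ih h)
  | box p q φ ih =>
    exact .base _ ⟨p, q, ⟨_, ih h⟩, Set.ext fun g => ⟨fun ⟨_, hg⟩ => hg, fun hg => ⟨ih h, hg⟩⟩⟩

/-- The interpretation of the formulas is invariant under coalgebra morphisms. -/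
theorem RawForm.preimage_interp {X Y : TCoalg M T} (f : X ⟶ Y) {S : UPoly ι} (φ : RawForm M T S)
    (h : φ.WF) : Unc.fn ((S.functor M).map f.f) ⁻¹' φ.interp Y = φ.interp X := by
  induction φ with
  | bot => rfl
  | imp φ ψ ih₁ ih₂ =>
    change (Unc.fn _ ⁻¹' _)ᶜ ∪ Unc.fn _ ⁻¹' _ = _
    rw [ih₁ h.1, ih₂ h.2]
    rfl
  | atom A => rfl
  | pr₁ φ ih =>
    ext x
    exact Set.ext_iff.1 (ih h) x.1
  | pr₂ φ ih =>
    ext x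
    exact Set.ext_iff.1 (ih h) x.2
  | in₁ φ ih =>
    ext x
    rcases x with x | x
    · exact Set.inl_mem_image_union_range.trans
        ((Set.ext_iff.1 (ih h) x).trans Set.inl_mem_image_union_range.symm)
    · exact ⟨fun _ => Or.inr ⟨x, rfl⟩, fun _ => Or.inr ⟨_, rfl⟩⟩
  | in₂ φ ih =>
    ext x
    rcases x with x | x
    · exact ⟨fun _ => Or.inl ⟨x, rfl⟩, fun _ => Or.inl ⟨_, rfl⟩⟩
    · exact Set.inr_mem_range_union_image.trans
        ((Set.ext_iff.1 (ih h) x).trans Set.inr_mem_range_union_image.symm)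
  | next φ ih =>
    ext x
    have h1 := congrArg (fun k => Unc.fn k x) f.h
    have h2 := Set.ext_iff.1 (ih h) (Unc.fn X.str x)
    change Unc.fn Y.str (Unc.fn f.f x) ∈ φ.interp Y ↔ Unc.fn X.str x ∈ φ.interp X
    rw [← h2]
    change Unc.fn (X.str ≫ (T.functor M).map f.f) x = Unc.fn (f.f ≫ Y.str) x at h1
    exact Iff.of_eq (congrArg (· ∈ φ.interp Y) h1.symm)
  | @box S p q φ ih =>
    have hX := φ.interp_mem_alg X h
    have hY := φ.interp_mem_alg Y h
    have e := ih (RawForm.Meas.wf h)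
    ext g
    -- Generalising the preimage to `U` allows the equation of sets to be substituted together with
    -- the bundled measurability proof.
    have key : ∀ (U : ((S.functor M).obj X.V).alg),
        Unc.fn ((S.functor M).map f.f) ⁻¹' φ.interp Y = U.1 →
        (Unc.fn (Unc.deltaMap ((S.functor M).map f.f)) g ∈
          ((S.functor M).obj Y.V).beta p q ⟨_, hY⟩ ↔ g ∈ ((S.functor M).obj X.V).beta p q U) := by
      rintro ⟨_, hU⟩ rfl
      rfl
    exact ⟨fun ⟨_, hg⟩ => ⟨hX, (key ⟨_, hX⟩ e).1 hg⟩, fun ⟨_, hg⟩ => ⟨hY, (key ⟨_, hX⟩ e).2 hg⟩⟩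

namespace DeductionSystem

variable {D : DeductionSystem M T}

/-- The description map as a morphism of uncertainty spaces. -/
def desHom (hD : D.Sound) (Y : TCoalg M T) {S : UPoly ι} (hS : S ∈ T.Ing) :
    (S.functor M).obj Y.V ⟶ D.space hS :=
  Unc.Hom.mk (X := (S.functor M).obj Y.V) (Y := D.space hS) (des hD Y hS) (by
    rintro _ ⟨φ, hφ, rfl⟩
    exact φ.1.interp_mem_alg Y hφ)

theorem des_map (hD : D.Sound) {X Y : TCoalg M T} (f : X ⟶ Y) {S : UPoly ι} (hS : S ∈ T.Ing)
    (x : ((S.functor M).obj X.V).carrier) :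
    des hD Y hS (Unc.fn ((S.functor M).map f.f) x) = des hD X hS x :=
  Subtype.ext (Set.ext fun φ => Set.ext_iff.1 (φ.1.preimage_interp f φ.2) x)

/-! ### The maps from maximal sets to points of the canonical coalgebra -/

section Modalities

variable {S₁ S₂ : UPoly ι}

theorem IsMaximal.pr₁ {hS : S₁.prod S₂ ∈ T.Ing} {x : Set (Form M T (S₁.prod S₂))}
    (hx : D.IsMaximal hS x) : D.IsMaximal (UPoly.prod_left_mem hS) {φ | Form.pr₁ φ ∈ x} :=
  hx.preimage Form.pr₁ (fun φ h => (hx.imp_iff _ _).1 (hx.ax (.pr₁_neg φ)) h)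
    ((hx.neg_iff _).1 (hx.ax .pr₁_bot)) (D.box_pr₁ hS)

theorem IsMaximal.pr₂ {hS : S₁.prod S₂ ∈ T.Ing} {x : Set (Form M T (S₁.prod S₂))}
    (hx : D.IsMaximal hS x) : D.IsMaximal (UPoly.prod_right_mem hS) {φ | Form.pr₂ φ ∈ x} :=
  hx.preimage Form.pr₂ (fun φ h => (hx.imp_iff _ _).1 (hx.ax (.pr₂_neg φ)) h)
    ((hx.neg_iff _).1 (hx.ax .pr₂_bot)) (D.box_pr₂ hS)

/-- The hypothesis is needed because [in₁]⊥ is satisfiable: it holds at the points of the right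
summand. -/
theorem IsMaximal.in₁ {hS : S₁.sum S₂ ∈ T.Ing} {x : Set (Form M T (S₁.sum S₂))}
    (hx : D.IsMaximal hS x) (h : (Form.in₁ Form.bot).neg ∈ x) :
    D.IsMaximal (UPoly.sum_left_mem hS) {φ | Form.in₁ φ ∈ x} :=
  hx.preimage Form.in₁ (fun φ h => (hx.imp_iff _ _).1 (hx.ax (.in₁_neg φ)) h)
    ((hx.neg_iff _).1 h) (D.box_in₁ hS)

theorem IsMaximal.in₂ {hS : S₁.sum S₂ ∈ T.Ing} {x : Set (Form M T (S₁.sum S₂))}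
    (hx : D.IsMaximal hS x) (h : (Form.in₂ Form.bot).neg ∈ x) :
    D.IsMaximal (UPoly.sum_right_mem hS) {φ | Form.in₂ φ ∈ x} :=
  hx.preimage Form.in₂ (fun φ h => (hx.imp_iff _ _).1 (hx.ax (.in₂_neg φ)) h)
    ((hx.neg_iff _).1 h) (D.box_in₂ hS)

theorem IsMaximal.in₂_bot_neg_iff {hS : S₁.sum S₂ ∈ T.Ing} {x : Set (Form M T (S₁.sum S₂))}
    (hx : D.IsMaximal hS x) :
    (Form.in₂ Form.bot).neg ∈ x ↔ (Form.in₁ Form.bot).neg ∉ x := by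
  rw [hx.neg_iff, ← (hx.iff_iff _ _).1 (hx.ax .in_bot)]

/-- On the right summand [in₁]⊥ holds and ⊥ entails everything, matching the semantic clause that
adds the whole other summand. -/
theorem IsMaximal.in₁_mem {hS : S₁.sum S₂ ∈ T.Ing} {x : Set (Form M T (S₁.sum S₂))}
    (hx : D.IsMaximal hS x) (h : (Form.in₂ Form.bot).neg ∈ x) (φ : Form M T S₁) :
    Form.in₁ φ ∈ x := by
  have hbot : Form.in₁ Form.bot ∈ x := by
    have := hx.in₂_bot_neg_iff.1 h
    rwa [hx.neg_iff, not_not] at this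
  refine hx.closed_of_forall_mem (D.box_in₁ hS {Form.bot} φ ?_) ?_
  · refine D.cut _ _ {Form.bot, Form.bot.imp φ} _ ?_ (D.modusPonens _ _ _)
    rintro ψ (rfl | rfl)
    · exact D.assumption _ _ _ (Or.inl rfl)
    · exact D.assumption _ _ _ (Or.inr (.tautology _ fun v hb hv => by simp [hv, hb]))
  · rintro _ ⟨_, rfl, rfl⟩
    exact hbot

theorem IsMaximal.in₂_mem {hS : S₁.sum S₂ ∈ T.Ing} {x : Set (Form M T (S₁.sum S₂))}
    (hx : D.IsMaximal hS x) (h : (Form.in₁ Form.bot).neg ∈ x) (φ : Form M T S₂) :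
    Form.in₂ φ ∈ x := by
  have hbot : Form.in₂ Form.bot ∈ x := ((hx.iff_iff _ _).1 (hx.ax .in_bot)).1 h
  refine hx.closed_of_forall_mem (D.box_in₂ hS {Form.bot} φ ?_) ?_
  · refine D.cut _ _ {Form.bot, Form.bot.imp φ} _ ?_ (D.modusPonens _ _ _)
    rintro ψ (rfl | rfl)
    · exact D.assumption _ _ _ (Or.inl rfl)
    · exact D.assumption _ _ _ (Or.inr (.tautology _ fun v hb hv => by simp [hv, hb]))
  · rintro _ ⟨_, rfl, rfl⟩
    exact hbot

/-- Otherwise x would contain all the negations ¬{c}, from which the infinitary rule for constants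
derives ⊥. -/
theorem IsMaximal.exists_single_mem {i : ι} {hS : UPoly.const i ∈ T.Ing}
    {x : Set (Form M T (.const i))} (hx : D.IsMaximal hS x) :
    ∃ c : (M i).carrier, Form.single c ∈ x := by
  by_contra! h
  refine hx.bot_notMem (hx.closed_of_forall_mem (D.constant hS) ?_)
  rintro _ ⟨c, rfl⟩
  exact (hx.neg_iff _).2 (h c)

theorem IsMaximal.atom_iff {i : ι} {hS : UPoly.const i ∈ T.Ing}
    {x : Set (Form M T (.const i))} (hx : D.IsMaximal hS x) {c : (M i).carrier}
    (hc : Form.single c ∈ x) (A : Set (M i).carrier) (hA : A ∈ (M i).alg ∨ ∃ d, A = {d}) :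
    Form.atom A hA ∈ x ↔ c ∈ A := by
  by_cases h : c ∈ A
  · exact iff_of_true ((hx.imp_iff _ _).1 (hx.ax (.const_mem c A hA h)) hc) h
  · exact iff_of_false ((hx.neg_iff _).1
      ((hx.imp_iff _ _).1 (hx.ax (.const_notMem c A hA h)) hc)) h

variable (D) in
/-- A maximal set of constant sort contains exactly one singleton. -/
noncomputable def constPoint {i : ι} (hS : UPoly.const i ∈ T.Ing) : D.space hS ⟶ M i :=
  Unc.Hom.mk (X := D.space hS) (Y := M i) (fun x => x.2.exists_single_mem.choose) (by
    intro U hU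
    refine ⟨Form.atom U (Or.inl hU), hU, ?_⟩
    ext x
    exact (x.2.atom_iff x.2.exists_single_mem.choose_spec U (Or.inl hU)).symm)

theorem single_constPoint_mem {i : ι} {hS : UPoly.const i ∈ T.Ing} (x : (D.space hS).carrier) :
    Form.single (Unc.fn (D.constPoint hS) x) ∈ x.1 :=
  x.2.exists_single_mem.choose_spec

variable (D) in
/-- The components of a maximal set of product sort. -/
def prodSplit (hS : S₁.prod S₂ ∈ T.Ing) :
    D.space hS ⟶ (D.space (UPoly.prod_left_mem hS)).prod (D.space (UPoly.prod_right_mem hS)) :=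
  Unc.Hom.mk (X := D.space hS) (Y := (D.space _).prod (D.space _))
    (fun x => (⟨_, x.2.pr₁⟩, ⟨_, x.2.pr₂⟩)) (by
    refine Unc.preimage_generate (X := D.space hS) _ ?_
    rintro _ ⟨_, ⟨φ, hφ, rfl⟩, _, ⟨ψ, hψ, rfl⟩, rfl⟩
    -- The rectangle |φ| × |ψ| pulls back to |[pr₁]φ ∧ [pr₂]ψ|.
    refine ⟨(Form.pr₁ φ).and (Form.pr₂ ψ),
      Form.Meas.and (φ := Form.pr₁ φ) (ψ := Form.pr₂ ψ) hφ hψ, ?_⟩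
    ext x
    exact (x.2.and_iff _ _).symm)

open Classical in
/-- The underlying function of `sumSplit`. -/
noncomputable def sumSplitFun {hS : S₁.sum S₂ ∈ T.Ing} (x : (D.space hS).carrier) :
    (D.space (UPoly.sum_left_mem hS)).carrier ⊕ (D.space (UPoly.sum_right_mem hS)).carrier :=
  if h : (Form.in₁ Form.bot).neg ∈ x.1 then .inl ⟨_, x.2.in₁ h⟩
  else .inr ⟨_, x.2.in₂ (x.2.in₂_bot_neg_iff.2 h)⟩

theorem sumSplitFun_of_mem {hS : S₁.sum S₂ ∈ T.Ing} {x : (D.space hS).carrier}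
    (h : (Form.in₁ Form.bot).neg ∈ x.1) : sumSplitFun x = .inl ⟨_, x.2.in₁ h⟩ := dif_pos h

theorem sumSplitFun_of_notMem {hS : S₁.sum S₂ ∈ T.Ing} {x : (D.space hS).carrier}
    (h : (Form.in₁ Form.bot).neg ∉ x.1) :
    sumSplitFun x = .inr ⟨_, x.2.in₂ (x.2.in₂_bot_neg_iff.2 h)⟩ := dif_neg h

variable (D) in
/-- The component of a maximal set of coproduct sort. -/
noncomputable def sumSplit (hS : S₁.sum S₂ ∈ T.Ing) :
    D.space hS ⟶ (D.space (UPoly.sum_left_mem hS)).sum (D.space (UPoly.sum_right_mem hS)) :=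
  Unc.Hom.mk (X := D.space hS) (Y := (D.space _).sum (D.space _)) sumSplitFun (by
    refine Unc.preimage_generate (X := D.space hS) _ ?_
    rintro _ (⟨_, ⟨φ, hφ, rfl⟩, rfl⟩ | ⟨_, ⟨φ, hφ, rfl⟩, rfl⟩)
    -- The first conjunct removes the maximal sets of the right summand, where [in₁]φ holds
    -- vacuously.
    · refine ⟨(Form.in₁ Form.bot).neg.and (Form.in₁ φ),
        Form.Meas.and (φ := (Form.in₁ Form.bot).neg) (ψ := Form.in₁ φ) ⟨trivial, trivial⟩ hφ, ?_⟩
      ext x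
      refine Iff.trans ?_ (x.2.and_iff _ _).symm
      change sumSplitFun x ∈ Sum.inl '' _ ↔ _
      by_cases h : (Form.in₁ Form.bot).neg ∈ x.1
      · rw [sumSplitFun_of_mem h]
        exact Sum.inl_injective.mem_set_image.trans (and_iff_right h).symm
      · rw [sumSplitFun_of_notMem h]
        exact iff_of_false (fun ⟨_, _, e⟩ => Sum.inl_ne_inr e) fun h' => h h'.1
    · refine ⟨(Form.in₂ Form.bot).neg.and (Form.in₂ φ),
        Form.Meas.and (φ := (Form.in₂ Form.bot).neg) (ψ := Form.in₂ φ) ⟨trivial, trivial⟩ hφ, ?_⟩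
      ext x
      refine Iff.trans ?_ (x.2.and_iff _ _).symm
      change sumSplitFun x ∈ Sum.inr '' _ ↔ _
      rw [x.2.in₂_bot_neg_iff]
      by_cases h : (Form.in₁ Form.bot).neg ∈ x.1
      · rw [sumSplitFun_of_mem h]
        exact iff_of_false (fun ⟨_, _, e⟩ => Sum.inr_ne_inl e) fun h' => h'.1 h
      · rw [sumSplitFun_of_notMem h]
        exact Sum.inr_injective.mem_set_image.trans (and_iff_right h).symm)

/-- The upper probability on maximal sets determined by a maximal set of sort `Δ*S`. -/
noncomputable def deltaSplit (hL : D.Lindenbaum) {S : UPoly ι} (hS : S.delta ∈ T.Ing) :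
    D.space hS ⟶ (D.space (UPoly.delta_mem hS)).delta :=
  Unc.Hom.mk (X := D.space hS) (Y := (D.space _).delta)
    (fun x => ⟨canonicalFun hS x.1, x.2.isUpperProb hL⟩) (by
    refine Unc.preimage_generate (X := D.space hS) _ ?_
    rintro _ ⟨p, q, U, rfl⟩
    refine ⟨Form.box p q (D.formOf U) (formOf_meas U), formOf_meas U, ?_⟩
    ext x
    refine Iff.trans ?_ (x.2.box_iff (formOf_meas U) p q).symm
    change _ ≤ canonicalFun hS x.1 U ∧ _ ≤ 1 - canonicalFun hS x.1 _ ↔ _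
    -- At the complement of `U` the chosen formula may differ from the negation of the one chosen
    -- for `U`; the value is the same.
    rw [x.2.canonicalFun_eq hL U (formOf_meas U) (ext_formOf U).symm,
      x.2.canonicalFun_eq hL ⟨U.1ᶜ, _⟩ (formOf_meas U).neg]
    ext y
    change y ∉ U.1 ↔ (D.formOf U).neg ∈ y.1
    rw [y.2.neg_iff, ← ext_formOf U]
    rfl)

end Modalities

/-! ### The maps r_S and their defining recursion -/

/-- The maps `r_S : X_S → S(X_Id)`. -/
noncomputable def toPoint (hL : D.Lindenbaum) :
    (S : UPoly ι) → (hS : S ∈ T.Ing) → (D.space hS ⟶ (S.functor M).obj D.spaceId)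
  | .ident, _ => 𝟙 D.spaceId
  | .const _, hS => D.constPoint hS
  | .prod S₁ S₂, hS => D.prodSplit hS ≫
      Unc.prodMap (toPoint hL S₁ (UPoly.prod_left_mem hS)) (toPoint hL S₂ (UPoly.prod_right_mem hS))
  | .sum S₁ S₂, hS => D.sumSplit hS ≫
      Unc.sumMap (toPoint hL S₁ (UPoly.sum_left_mem hS)) (toPoint hL S₂ (UPoly.sum_right_mem hS))
  | .delta S, hS => deltaSplit hL hS ≫ Unc.deltaMap (toPoint hL S (UPoly.delta_mem hS))

theorem toPoint_inl (hL : D.Lindenbaum) {S₁ S₂ : UPoly ι} (hS : S₁.sum S₂ ∈ T.Ing)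
    (x : (D.space hS).carrier) (h : (Form.in₁ Form.bot).neg ∈ x.1) :
    Unc.fn (toPoint hL _ hS) x =
      Sum.inl (Unc.fn (toPoint hL S₁ (UPoly.sum_left_mem hS)) ⟨_, x.2.in₁ h⟩) :=
  congrArg (Sum.map _ _) (sumSplitFun_of_mem h)

theorem toPoint_inr (hL : D.Lindenbaum) {S₁ S₂ : UPoly ι} (hS : S₁.sum S₂ ∈ T.Ing)
    (x : (D.space hS).carrier) (h : (Form.in₂ Form.bot).neg ∈ x.1) :
    Unc.fn (toPoint hL _ hS) x =
      Sum.inr (Unc.fn (toPoint hL S₂ (UPoly.sum_right_mem hS)) ⟨_, x.2.in₂ h⟩) :=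
  congrArg (Sum.map _ _) (sumSplitFun_of_notMem (x.2.in₂_bot_neg_iff.1 h))

theorem toPoint_delta (hL : D.Lindenbaum) {S : UPoly ι} (hS : S.delta ∈ T.Ing)
    (x : (D.space hS).carrier) (A : ((S.functor M).obj D.spaceId).alg) {φ : Form M T S}
    (hφ : φ.Meas) (h : Unc.fn (toPoint hL S (UPoly.delta_mem hS)) ⁻¹' A.1 = D.ext _ φ) :
    (show ((S.functor M).obj D.spaceId).delta.carrier from Unc.fn (toPoint hL _ hS) x).1 A =
      canonicalMeasure x.1 φ hφ :=
  x.2.canonicalFun_eq hL _ hφ h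

theorem exists_ext_eq_preimage (hL : D.Lindenbaum) {S : UPoly ι} (hS : S ∈ T.Ing)
    (A : ((S.functor M).obj D.spaceId).alg) :
    ∃ φ : Form M T S, φ.Meas ∧ Unc.fn (toPoint hL S hS) ⁻¹' A.1 = D.ext hS φ :=
  Unc.fn_meas (toPoint hL S hS) A.2

/-- Induction on the sort shows that the recursive relation on bare sets of formulas is, on maximal
sets, the graph of the bundled measurable map. -/
theorem rGraph_iff (hL : D.Lindenbaum) {S : UPoly ι} (hS : S ∈ T.Ing) (x : (D.space hS).carrier)
    (y : ((S.functor M).obj D.spaceId).carrier) :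
    D.RGraph hS x.1 y ↔ Unc.fn (toPoint hL S hS) x = y := by
  induction S with
  | ident => exact ⟨fun h => Subtype.ext h.symm, fun h => (congrArg Subtype.val h).symm⟩
  | const i =>
    have hc := single_constPoint_mem x
    refine ⟨fun h => ?_, fun h => h ▸ hc⟩
    exact (x.2.atom_iff hc _ (Or.inr ⟨_, rfl⟩)).1 h
  | prod S₁ S₂ ih₁ ih₂ =>
    exact (and_congr (ih₁ _ ⟨_, x.2.pr₁⟩ y.1) (ih₂ _ ⟨_, x.2.pr₂⟩ y.2)).trans
      (Prod.ext_iff (x := Unc.fn (toPoint hL _ hS) x)).symm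
  | sum S₁ S₂ ih₁ ih₂ =>
    by_cases h : (Form.in₁ Form.bot).neg ∈ x.1
    · rw [toPoint_inl hL hS x h]
      rcases y with y | y
      · exact (and_iff_right h).trans ((ih₁ _ ⟨_, x.2.in₁ h⟩ y).trans Sum.inl_injective.eq_iff.symm)
      · exact iff_of_false (fun h' => x.2.in₂_bot_neg_iff.1 h'.1 h) Sum.inl_ne_inr
    · have h2 := x.2.in₂_bot_neg_iff.2 h
      rw [toPoint_inr hL hS x h2]
      rcases y with y | y
      · exact iff_of_false (fun h' => h h'.1) Sum.inr_ne_inl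
      · exact (and_iff_right h2).trans
          ((ih₂ _ ⟨_, x.2.in₂ h2⟩ y).trans Sum.inr_injective.eq_iff.symm)
  | delta S ih =>
    -- By induction the set in the clause for Δ*S is the genuine preimage r_S⁻¹(A).
    have hpre : ∀ A : ((S.functor M).obj D.spaceId).alg,
        {z : (D.space (UPoly.delta_mem hS)).carrier |
          ∃ w ∈ A.1, D.RGraph (UPoly.delta_mem hS) z.1 w} =
        Unc.fn (toPoint hL S (UPoly.delta_mem hS)) ⁻¹' A.1 := by
      intro A
      ext z
      constructor
      · rintro ⟨w, hw, hz⟩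
        rw [ih] at hz
        exact (congrArg (· ∈ A.1) hz).mpr hw
      · exact fun hz => ⟨_, hz, (ih _ _ _).2 rfl⟩
    constructor
    · intro h
      refine Subtype.ext (funext fun A => ?_)
      -- Measurability of r_S supplies a defining formula; without one the clause for `A` would be
      -- vacuous.
      obtain ⟨φ, hφ, e⟩ := exists_ext_eq_preimage hL (UPoly.delta_mem hS) A
      exact (toPoint_delta hL hS x A hφ e).trans (h A φ hφ ((hpre A).trans e)).symm
    · rintro rfl A φ hφ e
      exact toPoint_delta hL hS x A hφ ((hpre A).symm.trans e)

/-! ### The canonical coalgebra -/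

variable (D) in
/-- The map `rhoId` as a morphism of uncertainty spaces. -/
def rhoHom : D.spaceId ⟶ D.space (UPoly.self_mem_Ing T) :=
  Unc.Hom.mk (X := D.spaceId) (Y := D.space (UPoly.self_mem_Ing T)) D.rhoId (by
    rintro _ ⟨φ, hφ, rfl⟩
    exact ⟨φ.next, hφ, rfl⟩)

/-- The canonical coalgebra on the maximal sets of sort `Id`. -/
noncomputable def canonical (hL : D.Lindenbaum) : TCoalg M T :=
  ⟨D.spaceId, D.rhoHom ≫ toPoint hL T T.self_mem_Ing⟩

/-- The truth lemma for the canonical coalgebra. -/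
theorem toPoint_mem_interp_iff (hL : D.Lindenbaum) {S : UPoly ι} (hS : S ∈ T.Ing)
    (φ : RawForm M T S) (h : φ.WF) (x : (D.space hS).carrier) :
    Unc.fn (toPoint hL S hS) x ∈ φ.interp (canonical hL) ↔ (⟨φ, h⟩ : Form M T S) ∈ x.1 := by
  induction φ with
  | bot => exact iff_of_false (fun h => h) x.2.bot_notMem
  | imp φ ψ ih₁ ih₂ =>
    exact imp_iff_not_or.symm.trans ((imp_congr (ih₁ hS h.1 x) (ih₂ hS h.2 x)).trans
      (x.2.imp_iff ⟨φ, h.1⟩ ⟨ψ, h.2⟩).symm)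
  | atom A => exact (x.2.atom_iff (single_constPoint_mem x) A h).symm
  | pr₁ φ ih => exact ih _ h ⟨_, x.2.pr₁⟩
  | pr₂ φ ih => exact ih _ h ⟨_, x.2.pr₂⟩
  | @in₁ S₁ S₂ φ ih =>
    by_cases hb : (Form.in₁ Form.bot).neg ∈ x.1
    · rw [toPoint_inl hL hS x hb]
      exact Set.inl_mem_image_union_range.trans (ih _ h ⟨_, x.2.in₁ hb⟩)
    · have hb' := x.2.in₂_bot_neg_iff.2 hb
      rw [toPoint_inr hL hS x hb']
      exact iff_of_true (Or.inr ⟨_, rfl⟩) (x.2.in₁_mem hb' ⟨φ, h⟩)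
  | @in₂ S₁ S₂ φ ih =>
    by_cases hb : (Form.in₁ Form.bot).neg ∈ x.1
    · rw [toPoint_inl hL hS x hb]
      exact iff_of_true (Or.inl ⟨_, rfl⟩) (x.2.in₂_mem hb ⟨φ, h⟩)
    · have hb' := x.2.in₂_bot_neg_iff.2 hb
      rw [toPoint_inr hL hS x hb']
      exact Set.inr_mem_range_union_image.trans (ih _ h ⟨_, x.2.in₂ hb'⟩)
  -- The structure map at `x` is r_T at [next]⁻x, so the induction hypothesis applies there.
  | next φ ih => exact ih _ h (D.rhoId x)
  | @box S p q φ ih =>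
    have hU := φ.interp_mem_alg (canonical hL) h
    have hφ := RawForm.Meas.wf h
    have e : Unc.fn (toPoint hL S (UPoly.delta_mem hS)) ⁻¹' φ.interp (canonical hL) =
        D.ext _ ⟨φ, hφ⟩ := Set.ext fun z => ih _ hφ z
    have e' : Unc.fn (toPoint hL S (UPoly.delta_mem hS)) ⁻¹' (φ.interp (canonical hL))ᶜ =
        D.ext _ (Form.neg ⟨φ, hφ⟩) := by
      ext z
      exact (not_congr (ih _ hφ z)).trans (z.2.neg_iff _).symm
    refine Iff.trans ?_ (x.2.box_iff (φ := ⟨φ, hφ⟩) h p q).symm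
    rw [← toPoint_delta hL hS x ⟨_, hU⟩ (φ := ⟨φ, hφ⟩) h e,
      ← toPoint_delta hL hS x ⟨_, (Unc.isAlg _).compl_mem hU⟩ (Form.Meas.neg (φ := ⟨φ, hφ⟩) h) e']
    exact ⟨fun ⟨_, hg⟩ => hg, fun hg => ⟨hU, hg⟩⟩

/-! ### Descriptions and points are mutually inverse -/

theorem des_toPoint (hL : D.Lindenbaum) (hD : D.Sound) {S : UPoly ι} (hS : S ∈ T.Ing)
    (x : (D.space hS).carrier) :
    des hD (canonical hL) hS (Unc.fn (toPoint hL S hS) x) = x :=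
  Subtype.ext (Set.ext fun φ => toPoint_mem_interp_iff hL hS φ.1 φ.2 x)

/-- Both numbers lie in [0,1] and have the same lower bounds there, since the satisfied formulas
u_{≥q}φ record exactly those bounds. -/
theorem canonicalMeasure_des (hD : D.Sound) (Y : TCoalg M T) {S : UPoly ι} (hS : S.delta ∈ T.Ing)
    (g : ((S.functor M).obj Y.V).delta.carrier) {φ : Form M T S} (hφ : φ.Meas) :
    canonicalMeasure (des hD Y hS g).1 φ hφ = g.1 ⟨_, φ.1.interp_mem_alg Y hφ⟩ := by
  have hg := g.2.mem_Icc
  have key : ∀ q : unitInterval, (q : ℝ) ≤ canonicalMeasure (des hD Y hS g).1 φ hφ ↔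
      (q : ℝ) ≤ g.1 ⟨_, φ.1.interp_mem_alg Y hφ⟩ := by
    intro q
    rw [← (des hD Y hS g).2.upperGe_iff hφ q]
    refine ⟨fun ⟨_, h⟩ => h.1, fun h => ⟨φ.1.interp_mem_alg Y hφ, h, ?_⟩⟩
    exact sub_nonneg.2 (hg _).2
  exact le_antisymm ((key ⟨_, canonicalMeasure_mem_Icc _ φ hφ⟩).1 le_rfl)
    ((key ⟨_, hg _⟩).2 le_rfl)

/-- The maps `r_S ∘ des_S` are the images of `des_Id` under the functors. -/
theorem toPoint_des (hL : D.Lindenbaum) (hD : D.Sound) (Y : TCoalg M T) {S : UPoly ι}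
    (hS : S ∈ T.Ing) (y : ((S.functor M).obj Y.V).carrier) :
    Unc.fn (toPoint hL S hS) (des hD Y hS y) =
      Unc.fn ((S.functor M).map (Y := D.spaceId) (desHom hD Y T.ident_mem_Ing)) y := by
  induction S with
  | ident => rfl
  | const i =>
    exact ((des hD Y hS y).2.atom_iff (single_constPoint_mem _) {y} (Or.inr ⟨y, rfl⟩)).1 rfl
  | prod S₁ S₂ ih₁ ih₂ => exact Prod.ext (ih₁ _ y.1) (ih₂ _ y.2)
  | sum S₁ S₂ ih₁ ih₂ =>
    rcases y with y | y
    · have h : (Form.in₁ Form.bot).neg ∈ (des hD Y hS (Sum.inl y)).1 := by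
        rw [IsMaximal.neg_iff (des hD Y hS (Sum.inl y)).2]
        rintro (⟨_, h, _⟩ | ⟨_, h⟩)
        exacts [h, Sum.inr_ne_inl h]
      rw [toPoint_inl hL hS _ h]
      refine congrArg Sum.inl (Eq.trans (congrArg _ (Subtype.ext (Set.ext fun φ => ?_)))
        (ih₁ (UPoly.sum_left_mem hS) y))
      exact Set.inl_mem_image_union_range (s := φ.1.interp Y)
    · have h : (Form.in₂ Form.bot).neg ∈ (des hD Y hS (Sum.inr y)).1 := by
        rw [IsMaximal.neg_iff (des hD Y hS (Sum.inr y)).2]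
        rintro (⟨_, h⟩ | ⟨_, h, _⟩)
        exacts [Sum.inl_ne_inr h, h]
      rw [toPoint_inr hL hS _ h]
      refine congrArg Sum.inr (Eq.trans (congrArg _ (Subtype.ext (Set.ext fun φ => ?_)))
        (ih₂ (UPoly.sum_right_mem hS) y))
      exact Set.inr_mem_range_union_image (s := φ.1.interp Y)
  | delta S ih =>
    refine Subtype.ext (funext fun A => ?_)
    obtain ⟨φ, hφ, e⟩ := exists_ext_eq_preimage hL (UPoly.delta_mem hS) A
    refine (toPoint_delta hL hS _ A hφ e).trans ((canonicalMeasure_des hD Y hS y hφ).trans ?_)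
    -- Both sets are pullbacks of r_S⁻¹(A) = |φ| along des_S: by the definition of des_S this is the
    -- interpretation of φ, by induction the preimage of `A` under S(des_Id).
    refine congrArg y.1 (Subtype.ext (Set.ext fun z => ?_))
    have h1 := Set.ext_iff.1 e (des hD Y (UPoly.delta_mem hS) z)
    rw [Set.mem_preimage, ih] at h1
    exact h1.symm

/-- As r_Id is the identity, the truth lemma at sort Id says that des_Id is the identity, and
functors preserve identities. -/
theorem toPoint_des_canonical (hL : D.Lindenbaum) (hD : D.Sound) {S : UPoly ι} (hS : S ∈ T.Ing)
    (y : ((S.functor M).obj D.spaceId).carrier) :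
    Unc.fn (toPoint hL S hS) (des hD (canonical hL) hS y) = y := by
  have hid : desHom hD (canonical hL) T.ident_mem_Ing = 𝟙 D.spaceId :=
    Unc.hom_ext fun x => des_toPoint hL hD T.ident_mem_Ing x
  refine (toPoint_des hL hD (canonical hL) hS y).trans ?_
  refine (congrArg (fun k => Unc.fn ((S.functor M).map k) y) hid).trans ?_
  exact congrArg (fun k => Unc.fn k y) ((S.functor M).map_id D.spaceId)

/-- The isomorphisms between the spaces `S(X_Id)` and `X_S`. -/
noncomputable def desIso (hL : D.Lindenbaum) (hD : D.Sound) {S : UPoly ι} (hS : S ∈ T.Ing) :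
    (S.functor M).obj D.spaceId ≅ D.space hS where
  hom := desHom hD (canonical hL) hS
  inv := toPoint hL S hS
  hom_inv_id := Unc.hom_ext (toPoint_des_canonical hL hD hS)
  inv_hom_id := Unc.hom_ext (des_toPoint hL hD hS)

/-! ### Finality -/

/-- The description map of a coalgebra as a morphism into the canonical coalgebra. -/
noncomputable def desCoalgHom (hL : D.Lindenbaum) (hD : D.Sound) (Y : TCoalg M T) :
    Y ⟶ canonical hL where
  f := desHom hD Y T.ident_mem_Ing
  -- The square is r_T ∘ des_T = T(des_Id) at the successor of `y`, because [next]⁻ of the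
  -- description of `y` is the description of that successor.
  h := Unc.hom_ext fun y => (toPoint_des hL hD Y T.self_mem_Ing (Unc.fn Y.str y)).symm

/-- The point f(y) equals its own description, which is the description of y since f preserves
descriptions. -/
theorem eq_desCoalgHom (hL : D.Lindenbaum) (hD : D.Sound) (Y : TCoalg M T)
    (f : Y ⟶ canonical hL) : f = desCoalgHom hL hD Y :=
  Endofunctor.Coalgebra.Hom.ext (Unc.hom_ext fun y =>
    (des_toPoint hL hD T.ident_mem_Ing (Unc.fn f.f y)).symm.trans (des_map hD f T.ident_mem_Ing y))

end DeductionSystem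

end MaximalSets

theorem theorem4p7 {ι : Type u} (M : ι → Unc.{u}) (T : UPoly ι) (D : DeductionSystem M T)
    (hL : D.Lindenbaum) (hD : D.Sound) :
    -- the description maps are measurable
    (∀ (Y : TCoalg M T) (S : UPoly ι) (hS : S ∈ T.Ing),
      ∀ U ∈ (D.space hS).alg, DeductionSystem.des hD Y hS ⁻¹' U ∈ ((S.functor M).obj Y.V).alg) ∧
    -- coalgebra morphisms preserve the description maps
    (∀ (X Y : TCoalg M T) (f : X ⟶ Y) (S : UPoly ι) (hS : S ∈ T.Ing)
      (x : ((S.functor M).obj X.V).carrier),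
      DeductionSystem.des hD Y hS (Unc.fn ((S.functor M).map f.f) x) =
        DeductionSystem.des hD X hS x) ∧
    -- the recursion for the maps `r_S` defines (unique) measurable maps
    ∃ r : (S : UPoly ι) → (hS : S ∈ T.Ing) → (D.space hS ⟶ (S.functor M).obj D.spaceId),
      (∀ (S : UPoly ι) (hS : S ∈ T.Ing) (x : (D.space hS).carrier)
        (y : ((S.functor M).obj D.spaceId).carrier),
        D.RGraph hS x.1 y ↔ Unc.fn (r S hS) x = y) ∧
      -- so that the canonical coalgebra `α = r_T ∘ ρ_Id` is well defined
      ∃ α : D.spaceId ⟶ (T.functor M).obj D.spaceId,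
        (∀ x, Unc.fn α x = Unc.fn (r T T.self_mem_Ing) (D.rhoId x)) ∧
        -- for the canonical coalgebra, `des_S` is an isomorphism with inverse `r_S`
        (∀ (S : UPoly ι) (hS : S ∈ T.Ing),
          (∃ e : (S.functor M).obj D.spaceId ≅ D.space hS,
            Unc.fn e.hom = DeductionSystem.des hD ⟨D.spaceId, α⟩ hS ∧ e.inv = r S hS) ∧
          {z | ∃ x, z = DeductionSystem.des hD ⟨D.spaceId, α⟩ hS (Unc.fn (r S hS) x)} =
            Set.univ) ∧
        -- `des_Id` is the only coalgebra morphism into the canonical coalgebra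
        (∀ Y : TCoalg M T, ∃ f : Y ⟶ (⟨D.spaceId, α⟩ : TCoalg M T),
          Unc.fn f.f = DeductionSystem.des hD Y T.ident_mem_Ing ∧
          ∀ f' : Y ⟶ (⟨D.spaceId, α⟩ : TCoalg M T), f' = f) ∧
        Nonempty (Limits.IsTerminal (⟨D.spaceId, α⟩ : TCoalg M T)) := by
  refine ⟨fun Y S hS _ hU => Unc.fn_meas (DeductionSystem.desHom hD Y hS) hU,
    fun X Y f S hS x => DeductionSystem.des_map hD f hS x, DeductionSystem.toPoint hL,
    fun S hS => DeductionSystem.rGraph_iff hL hS, (DeductionSystem.canonical hL).str,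
    fun x => rfl, fun S hS => ⟨⟨DeductionSystem.desIso hL hD hS, rfl, rfl⟩, ?_⟩,
    fun Y => ⟨DeductionSystem.desCoalgHom hL hD Y, rfl, DeductionSystem.eq_desCoalgHom hL hD Y⟩,
    ⟨Limits.IsTerminal.ofUniqueHom (DeductionSystem.desCoalgHom hL hD)
      (DeductionSystem.eq_desCoalgHom hL hD)⟩⟩
  exact Set.eq_univ_of_forall fun x => ⟨x, (DeductionSystem.des_toPoint hL hD hS x).symm⟩
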